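/- For $0<q\le 1$ let $$R(q)=\cfrac{q^{1/5}}{1+\cfrac{q}{1+\cfrac{q^2}{1+\cfrac{q^3}{1+\cdots}}}}$$ be the Rogers--Ramanujan continued fraction, let $\eta(\tau)=e^{\pi i\tau/12}\prod_{n\ge 1}(1-e^{2\pi i n\tau})$ be the Dedekind eta function, and let $\rho=\frac{\sqrt5-1}{2}$, the positive zero of $t^{-5}-11-t^5$. Let $G$ be a real-valued function that is smooth on $(0,\rho)$. For real $x$, call $m\ge 0$ a value of $m_G(x)$ if $$x=\pi\int_{\sqrt{m}}^{\infty}\eta(it/2)^4\,G\bigl(R(e^{-\pi t})\bigr)\,dt ,$$ where the integral converges absolutely. Let $0<y\le\rho$ and suppose that the integral $$5\int_0^y\frac{G(t)}{t\,\sqrt[6]{t^{-5}-11-t^5}}\,dt=A$$ converges absolutely and has the value $A$. Then there is a value $m$ of $m_G(A)$ with $y=R\bigl(e^{-\pi\sqrt{m}}\bigr)$. In particular, if the implicit equation has at most one solution $m\ge 0$ for $x=A$, then the number $m_G(A)$ is well defined by it and $$y=R\bigl(e^{-\pi\sqrt{m_G(A)}}\bigr).$$ -/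

import Mathlib

open scoped ContDiff

noncomputable section

namespace RogersRamanujan

/-- The Rogers–Ramanujan continued fraction
`q^{1/5} / (1 + q / (1 + q^2 / (1 + q^3 / (1 + ...))))`
as a formal generalized continued fraction: the integer part is `0`, all partial denominators
are `1`, and the partial numerators are `q^{1/5}, q, q^2, q^3, ...`. -/
def contFract (q : ℝ) : GenContFract ℝ where
  h := 0
  s := Stream'.Seq.ofStream
    (fun n : ℕ => (⟨if n = 0 then q ^ (1 / 5 : ℝ) else q ^ n, 1⟩ : GenContFract.Pair ℝ))

/-- The value `R(q)` of the Rogers–Ramanujan continued fraction: the limit of its convergents. -/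
def R (q : ℝ) : ℝ := Filter.limUnder Filter.atTop (fun n : ℕ => (contFract q).convs n)

/-- `(√5 - 1) / 2 = ((-11 + 5√5) / 2)^{1/5}`, the positive zero of `t^{-5} - 11 - t^5`.
On `(0, rMax)` the radicand `t^{-5} - 11 - t^5` is positive. -/
def rMax : ℝ := (√5 - 1) / 2

/-- The integrand `G(t) / (t (t^{-5} - 11 - t^5)^{1/6})`. -/
def integrand (G : ℝ → ℝ) (t : ℝ) : ℝ :=
  G t / (t * (t ^ (-5 : ℤ) - 11 - t ^ 5) ^ (1 / 6 : ℝ))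

/-- The integrand `η(it/2)^4 G(R(e^{-πt}))`, with `η` the Dedekind eta function. -/
def etaIntegrand (G : ℝ → ℝ) (t : ℝ) : ℂ :=
  ModularForm.eta (Complex.I * t / 2) ^ 4 * (G (R (Real.exp (-Real.pi * t))) : ℂ)

/-- `m` is a value of `m_G(x)`: the number `m ≥ 0` solves the implicit equation
`x = π ∫_{√m}^∞ η(it/2)^4 G(R(e^{-πt})) dt`, the integral being convergent. -/
def IsValue (G : ℝ → ℝ) (x m : ℝ) : Prop :=
  0 ≤ m ∧ MeasureTheory.IntegrableOn (etaIntegrand G) (Set.Ioi √m) ∧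
    (x : ℂ) = Real.pi * ∫ t in Set.Ioi √m, etaIntegrand G t

open Classical in
/-- The implicitly defined function `m_G`: a solution `m` of the implicit equation if there is
one (and `0` otherwise). -/
def mG (G : ℝ → ℝ) (x : ℝ) : ℝ :=
  if h : ∃ m, IsValue G x m then h.choose else 0

end RogersRamanujan

end

/-! The substitution `v = R(e^{-πt})` carries one integral into the other. This function of `t`
decreases strictly and continuously from `ρ` at `t = 0` to `0` at infinity, so `y = R(e^{-πs})` for
some `s ≥ 0`, and `m = s²` is the required value.

With `q = e^{-u}`, the Jacobian is supplied by two classical identities: `R^{-5} - 11 - R^5 =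
(η(q)/η(q^5))^6` (`R_relation`) and `-5 dR/du = R η(q)^5/η(q^5)` (`hasDerivAt_R_exp`). The sixth
root of the first cancels against the second and leaves `η^4`.

Both identities start from `R = thetaA/thetaB` (`R_exp`): Rogers' series solve the three-term
recurrence of the continued fraction, and the first two of them are theta series. The derivative of
the quotient is a Wronskian, identified with a multiple of `η^6` by splitting a double series along
cosets of `(2+i)ℤ[i]` (`tsum_sixthTerm_eq`). The algebraic relation is the norm over fifth roots of
unity of the five-dissection of the Euler product; the dissection coefficients are multiples of
`R^{-1}`, `1`, `R` by symmetries of the hexagonal lattice. The endpoint `q = 1`, where theta series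
are useless, is reached by squeezing `R` between convergents (`tendsto_R_one`). -/

namespace RogersRamanujan

open Filter Topology

/-! ### Finite form of Jacobi's triple product. -/

section TripleProduct

lemma hasSum_congr_both {ι M : Type*} [AddCommMonoid M] [TopologicalSpace M] {f g : ι → M}
    {a b : M} (h : HasSum f a) (hf : ∀ i, g i = f i) (hab : b = a) : HasSum g b := by
  rw [hab, funext hf]; exact h

variable {K : Type*} [NormedField K]

/-- The finite Euler product `(x; x)_n`. -/
def eulerFin (x : K) (n : ℕ) : K := ∏ i ∈ Finset.range n, (1 - x ^ (i + 1))

/-- The infinite Euler product `(x; x)_∞`. -/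
noncomputable def euler (x : K) : K := ∏' i : ℕ, (1 - x ^ (i + 1))

lemma eulerFin_succ (x : K) (n : ℕ) : eulerFin x (n + 1) = eulerFin x n * (1 - x ^ (n + 1)) :=
  Finset.prod_range_succ _ _

lemma one_sub_pow_ne_zero {x : K} (hx : ‖x‖ < 1) (n : ℕ) : 1 - x ^ (n + 1) ≠ 0 := by
  intro h
  have h1 : ‖x ^ (n + 1)‖ < 1 := by
    rw [norm_pow]; exact pow_lt_one₀ (norm_nonneg _) hx (by simp)
  rw [← sub_eq_zero.1 h] at h1
  simp at h1

lemma eulerFin_ne_zero {x : K} (hx : ‖x‖ < 1) (n : ℕ) : eulerFin x n ≠ 0 :=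
  Finset.prod_ne_zero_iff.2 fun i _ => one_sub_pow_ne_zero hx i

lemma multipliable_one_add_const_mul_pow [CompleteSpace K] {x : K} (hx : ‖x‖ < 1) (c : K)
    {m : ℕ} (hm : 0 < m) (l : ℕ) : Multipliable fun n : ℕ => 1 + c * x ^ (m * n + l) := by
  apply multipliable_one_add_of_summable
  have h1 : ‖x‖ ^ m < 1 := pow_lt_one₀ (norm_nonneg _) hx hm.ne'
  refine ((summable_geometric_of_lt_one (by positivity) h1).mul_left (‖c‖ * ‖x‖ ^ l)).congr ?_
  intro n
  rw [norm_mul, norm_pow, pow_add, pow_mul]; ring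

lemma multipliable_one_sub_pow_linear [CompleteSpace K] {x : K} (hx : ‖x‖ < 1)
    {m : ℕ} (hm : 0 < m) (l : ℕ) : Multipliable fun n : ℕ => 1 - x ^ (m * n + l) := by
  simpa [sub_eq_add_neg] using multipliable_one_add_const_mul_pow hx (-1) hm l

lemma tendsto_eulerFin [CompleteSpace K] {x : K} (hx : ‖x‖ < 1) :
    Tendsto (eulerFin x) atTop (𝓝 (euler x)) := by
  have := multipliable_one_sub_pow_linear hx one_pos 1
  simp only [one_mul] at this
  exact this.tendsto_prod_tprod_nat

lemma euler_ne_zero [CompleteSpace K] {x : K} (hx : ‖x‖ < 1) : euler x ≠ 0 := by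
  have := tprod_one_add_ne_zero_of_summable (f := fun n : ℕ => -x ^ (n + 1))
    (fun i => by simpa [sub_eq_add_neg] using one_sub_pow_ne_zero hx i)
    (by
      simpa [norm_pow] using (summable_nat_add_iff 1).2
        (summable_geometric_of_lt_one (norm_nonneg _) hx))
  simpa [euler, sub_eq_add_neg] using this

/-- The reciprocal of `(x; x)_n`, extended by zero to negative `n`. -/
def invEuler (x : K) (n : ℤ) : K := if n < 0 then 0 else (eulerFin x n.toNat)⁻¹

lemma invEuler_natCast (x : K) (n : ℕ) : invEuler x n = (eulerFin x n)⁻¹ := by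
  simp [invEuler]

/-- The extension by zero is consistent with the recurrence: at `n = -1` the factor `1 - x^0`
vanishes. Hence no boundary cases `k = ±N` arise below. -/
lemma invEuler_eq_mul_succ {x : K} (hx : ‖x‖ < 1) (n : ℤ) :
    invEuler x n = (1 - x ^ (n + 1)) * invEuler x (n + 1) := by
  rcases lt_trichotomy n (-1) with h | rfl | h
  · have h1 : n < 0 := by omega
    have h2 : n + 1 < 0 := by omega
    simp [invEuler, h1, h2]
  · simp [invEuler]
  · lift n to ℕ using by omega
    have : ((n : ℤ) + 1) = ((n + 1 : ℕ) : ℤ) := by push_cast; ring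
    rw [this, invEuler_natCast, invEuler_natCast, eulerFin_succ, zpow_natCast]
    have := one_sub_pow_ne_zero hx n
    have := eulerFin_ne_zero hx n
    field_simp

/-- The Laurent coefficients of the finite form of the triple product. -/
def tripleCoeff (p : K) (N : ℕ) (k : ℤ) : K :=
  eulerFin (p ^ 2) (2 * N) * invEuler (p ^ 2) (N + k) * invEuler (p ^ 2) (N - k)

lemma norm_sq_lt_one {p : K} (hp : ‖p‖ < 1) : ‖p ^ 2‖ < 1 := by
  rw [norm_pow]; exact pow_lt_one₀ (norm_nonneg _) hp two_ne_zero

/-- Coefficient comparison for multiplication by the next factor `1 + p^(4N+2) + p^(2N+1) (z + z⁻¹)`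
of the finite product. -/
lemma tripleCoeff_succ {p : K} (hp0 : p ≠ 0) (hp : ‖p‖ < 1) (N : ℕ) (k : ℤ) :
    tripleCoeff p (N + 1) k * p ^ (k ^ 2) =
      (1 + p ^ (4 * N + 2)) * (tripleCoeff p N k * p ^ (k ^ 2)) +
      p ^ (2 * N + 1) * (tripleCoeff p N (k - 1) * p ^ ((k - 1) ^ 2)
        + tripleCoeff p N (k + 1) * p ^ ((k + 1) ^ 2)) := by
  have hx := norm_sq_lt_one hp
  have e1 : p ^ ((k - 1) ^ 2) = p ^ (k ^ 2) * (p ^ k)⁻¹ ^ 2 * p := by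
    rw [show (k - 1) ^ 2 = k ^ 2 + (-k) * (2 : ℕ) + 1 by push_cast; ring, zpow_add₀ hp0,
      zpow_add₀ hp0, zpow_mul, zpow_natCast, zpow_neg, zpow_one]
  have e2 : p ^ ((k + 1) ^ 2) = p ^ (k ^ 2) * (p ^ k) ^ 2 * p := by
    rw [show (k + 1) ^ 2 = k ^ 2 + k * (2 : ℕ) + 1 by push_cast; ring, zpow_add₀ hp0,
      zpow_add₀ hp0, zpow_mul, zpow_natCast, zpow_one]
  have hk : p ^ k ≠ 0 := zpow_ne_zero _ hp0
  have f1 : ∀ m : ℤ, (p ^ 2) ^ (m + k) = (p ^ 2) ^ m * (p ^ k) ^ 2 := fun m => by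
    rw [zpow_add₀ (pow_ne_zero _ hp0), ← zpow_natCast p, ← zpow_natCast (p ^ k), ← zpow_mul p _ k,
      ← zpow_mul p k, mul_comm k]
  have f2 : ∀ m : ℤ, (p ^ 2) ^ (m - k) = (p ^ 2) ^ m * (p ^ k)⁻¹ ^ 2 := fun m => by
    rw [sub_eq_add_neg, zpow_add₀ (pow_ne_zero _ hp0), ← zpow_natCast p, zpow_neg,
      ← zpow_mul p _ k, inv_pow, ← zpow_natCast (p ^ k), ← zpow_mul p k, mul_comm k]
  have g1 : invEuler (p ^ 2) (N + k) =
      (1 - (p ^ 2) ^ (N + 1) * (p ^ k) ^ 2) * invEuler (p ^ 2) (N + k + 1) := by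
    rw [invEuler_eq_mul_succ hx, show (N : ℤ) + k + 1 = ((N + 1 : ℕ) : ℤ) + k by push_cast; ring,
      f1, zpow_natCast]
  have g2 : invEuler (p ^ 2) (N - k) =
      (1 - (p ^ 2) ^ (N + 1) * (p ^ k)⁻¹ ^ 2) * invEuler (p ^ 2) (N - k + 1) := by
    rw [invEuler_eq_mul_succ hx, show (N : ℤ) - k + 1 = ((N + 1 : ℕ) : ℤ) - k by push_cast; ring,
      f2, zpow_natCast]
  have g3 : invEuler (p ^ 2) (N + k - 1) =
      (1 - (p ^ 2) ^ N * (p ^ k) ^ 2) * invEuler (p ^ 2) (N + k) := by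
    rw [invEuler_eq_mul_succ hx, show (N : ℤ) + k - 1 + 1 = (N : ℤ) + k by ring,
      f1, zpow_natCast]
  have g4 : invEuler (p ^ 2) (N - k - 1) =
      (1 - (p ^ 2) ^ N * (p ^ k)⁻¹ ^ 2) * invEuler (p ^ 2) (N - k) := by
    rw [invEuler_eq_mul_succ hx, show (N : ℤ) - k - 1 + 1 = (N : ℤ) - k by ring,
      f2, zpow_natCast]
  have h1 : ((N + 1 : ℕ) : ℤ) + k = N + k + 1 := by push_cast; ring
  have h2 : ((N + 1 : ℕ) : ℤ) - k = N - k + 1 := by push_cast; ring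
  have h3 : (N : ℤ) + (k - 1) = N + k - 1 := by ring
  have h4 : (N : ℤ) - (k - 1) = N - k + 1 := by ring
  have h5 : (N : ℤ) + (k + 1) = N + k + 1 := by ring
  have h6 : (N : ℤ) - (k + 1) = N - k - 1 := by ring
  simp only [tripleCoeff, h1, h2, h3, h4, h5, h6]
  -- All reciprocals now refer to `N ± k + 1`; what remains is a rational identity in `p`, `p^N` and
  -- `p^k`.
  rw [g3, g4, g1, g2, e1, e2, show 2 * (N + 1) = 2 * N + 1 + 1 by ring, eulerFin_succ,
    eulerFin_succ]
  generalize invEuler (p ^ 2) (N + k + 1) = u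
  generalize invEuler (p ^ 2) (N - k + 1) = v
  generalize p ^ (k ^ 2) = w
  generalize eulerFin (p ^ 2) (2 * N) = e
  generalize p ^ k = a at *
  field_simp
  ring

/-- The finite triple product `∏_{j<N} (1 + z p^{2j+1}) (1 + z⁻¹ p^{2j+1})`. -/
def tripleFin (p z : K) (N : ℕ) : K :=
  ∏ j ∈ Finset.range N, ((1 + z * p ^ (2 * j + 1)) * (1 + z⁻¹ * p ^ (2 * j + 1)))

lemma tripleCoeff_zero (p : K) (k : ℤ) : tripleCoeff p 0 k = if k = 0 then 1 else 0 := by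
  rcases lt_trichotomy k 0 with h | rfl | h
  · simp [tripleCoeff, invEuler, h, h.ne]
  · simp [tripleCoeff, invEuler, eulerFin]
  · simp [tripleCoeff, invEuler, h, h.ne']

lemma hasSum_tripleFin {p z : K} (hp0 : p ≠ 0) (hp : ‖p‖ < 1) (hz : z ≠ 0) (N : ℕ) :
    HasSum (fun k : ℤ => tripleCoeff p N k * p ^ (k ^ 2) * z ^ k) (tripleFin p z N) := by
  induction N with
  | zero =>
    refine hasSum_congr_both (hasSum_ite_eq (0 : ℤ) (1 : K)) (fun k => ?_) (by simp [tripleFin])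
    · rw [tripleCoeff_zero]; split_ifs with h <;> simp [h]
  | succ N ih =>
    have h1 := ((Equiv.subRight (1 : ℤ)).hasSum_iff.2 ih).mul_left z
    have h2 := ((Equiv.addRight (1 : ℤ)).hasSum_iff.2 ih).mul_left z⁻¹
    have h3 := (ih.mul_left (1 + p ^ (4 * N + 2))).add ((h1.add h2).mul_left (p ^ (2 * N + 1)))
    refine hasSum_congr_both h3 (fun k => ?_) ?_
    · simp only [tripleCoeff_succ hp0 hp, Function.comp, Equiv.subRight_apply,
        Equiv.coe_addRight, zpow_sub₀ hz, zpow_add₀ hz, zpow_one]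
      field_simp
    · rw [tripleFin, Finset.prod_range_succ, ← tripleFin]
      field_simp
      ring

/-- The sum is `z d/dz` of the finite product at its zero `z = -p`, so only the term differentiating
the vanishing factor survives. -/
lemma hasSum_mul_tripleFin {p : K} (hp0 : p ≠ 0) (hp : ‖p‖ < 1) (N : ℕ) :
    HasSum (fun k : ℤ => k * (tripleCoeff p (N + 1) k * p ^ (k ^ 2) * (-p) ^ k))
      (eulerFin (p ^ 2) (N + 1) * eulerFin (p ^ 2) N) := by
  have hz : -p ≠ 0 := neg_ne_zero.2 hp0
  -- The Leibniz rule on coefficients, with no derivative taken: at `z = -p` the new factor is `(1 -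
  -- p^(2N+2))(1 - p^(2N))` and its `z d/dz` is `p^(2N)(1 - p²)`.
  have key : ∀ (N : ℕ) (D : K),
      HasSum (fun k : ℤ => k * (tripleCoeff p N k * p ^ (k ^ 2) * (-p) ^ k)) D →
      HasSum (fun k : ℤ => k * (tripleCoeff p (N + 1) k * p ^ (k ^ 2) * (-p) ^ k))
        (D * ((1 - p ^ (2 * N + 2)) * (1 - p ^ (2 * N)))
          + p ^ (2 * N) * (1 - p ^ 2) * tripleFin p (-p) N) := by
    intro N D hD
    have ih := hasSum_tripleFin hp0 hp hz N
    have h1 := ((Equiv.subRight (1 : ℤ)).hasSum_iff.2 (hD.add ih)).mul_left (-p)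
    have h2 := ((Equiv.addRight (1 : ℤ)).hasSum_iff.2 (hD.sub ih)).mul_left (-p)⁻¹
    have h3 := (hD.mul_left (1 + p ^ (4 * N + 2))).add ((h1.add h2).mul_left (p ^ (2 * N + 1)))
    refine hasSum_congr_both h3 (fun k => ?_) ?_
    · simp only [tripleCoeff_succ hp0 hp, Function.comp, Equiv.subRight_apply,
        Equiv.coe_addRight, zpow_sub₀ hz, zpow_add₀ hz, zpow_one]
      push_cast
      field_simp
      ring
    · field_simp
      ring
  induction N with
  | zero =>
    have h0 : HasSum (fun k : ℤ => k * (tripleCoeff p 0 k * p ^ (k ^ 2) * (-p) ^ k)) 0 := by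
      refine hasSum_congr_both hasSum_zero (fun k => ?_) rfl
      rw [tripleCoeff_zero]; split_ifs with h <;> simp [h]
    have := key 0 0 h0
    simpa [eulerFin, tripleFin] using this
  | succ N ih =>
    have h1 := key (N + 1) _ ih
    have h0 : tripleFin p (-p) (N + 1) = 0 := by
      rw [tripleFin]
      refine Finset.prod_eq_zero (i := 0) (by simp) ?_
      simp [hp0]
    rw [h0, mul_zero, add_zero] at h1
    convert h1 using 1
    rw [eulerFin_succ _ (N + 1), eulerFin_succ _ N]
    ring

end TripleProduct

/-! ### Passage to the limit: the triple product and Jacobi's formula for the cube. -/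

section TripleProductLimit

variable {K : Type*} [NormedField K]

lemma summable_abs_pow_mul_gaussian {p z : K} (hp0 : p ≠ 0) (hp : ‖p‖ < 1) (hz : z ≠ 0) (j : ℕ) :
    Summable fun k : ℤ => (|k| : ℝ) ^ j * (‖p‖ ^ (k ^ 2) * ‖z‖ ^ k) := by
  have hp1 : 0 < ‖p‖ := norm_pos_iff.2 hp0
  have hz1 : 0 < ‖z‖ := norm_pos_iff.2 hz
  have hT : 0 < -Real.log ‖p‖ / Real.pi :=
    div_pos (neg_pos.2 (Real.log_neg hp1 hp)) Real.pi_pos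
  refine Summable.of_nonneg_of_le (fun k => by positivity) (fun k => ?_)
    (summable_pow_mul_jacobiTheta₂_term_bound (|Real.log ‖z‖| / (2 * Real.pi)) hT j)
  gcongr
  · norm_cast
  have e1 : ‖p‖ ^ (k ^ 2) = Real.exp (Real.log ‖p‖ * k ^ 2) := by
    rw [Real.exp_mul, Real.exp_log hp1, ← Real.rpow_intCast]; push_cast; rfl
  have e2 : ‖z‖ ^ k = Real.exp (Real.log ‖z‖ * k) := by
    rw [Real.exp_mul, Real.exp_log hz1, Real.rpow_intCast]
  rw [e1, e2, ← Real.exp_add]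
  apply Real.exp_le_exp.2
  have h1 : Real.log ‖z‖ * k ≤ |Real.log ‖z‖| * |(k : ℝ)| := by
    rw [← abs_mul]; exact le_abs_self _
  have h2 : -Real.pi * (-Real.log ‖p‖ / Real.pi * k ^ 2
      - 2 * (|Real.log ‖z‖| / (2 * Real.pi)) * |(k : ℝ)|) =
      Real.log ‖p‖ * k ^ 2 + |Real.log ‖z‖| * |(k : ℝ)| := by
    field_simp
    ring
  push_cast at h2 ⊢
  linarith

variable [CompleteSpace K]

lemma exists_bound_eulerFin {x : K} (hx : ‖x‖ < 1) : ∃ C, ∀ n, ‖eulerFin x n‖ ≤ C := by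
  obtain ⟨C, hC⟩ := (Metric.isBounded_range_of_tendsto _ (tendsto_eulerFin hx)).exists_norm_le
  exact ⟨C, fun n => hC _ ⟨n, rfl⟩⟩

lemma exists_bound_invEuler {x : K} (hx : ‖x‖ < 1) : ∃ C, ∀ n : ℤ, ‖invEuler x n‖ ≤ C := by
  have h := (tendsto_eulerFin hx).inv₀ (euler_ne_zero hx)
  obtain ⟨C, hC⟩ := (Metric.isBounded_range_of_tendsto _ h).exists_norm_le
  refine ⟨C, fun n => ?_⟩
  have h0 : 0 ≤ C := (norm_nonneg _).trans (hC _ ⟨0, rfl⟩)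
  rw [invEuler]
  split_ifs
  · simpa using h0
  · exact hC _ ⟨n.toNat, rfl⟩

lemma tendsto_invEuler {x : K} (hx : ‖x‖ < 1) :
    Tendsto (invEuler x) atTop (𝓝 (euler x)⁻¹) := by
  have h := (tendsto_eulerFin hx).inv₀ (euler_ne_zero hx)
  have h2 : Tendsto Int.toNat atTop atTop :=
    tendsto_atTop_atTop.2 fun b => ⟨b, fun a ha => by omega⟩
  refine (h.comp h2).congr' ?_
  filter_upwards [eventually_ge_atTop 0] with n hn
  simp [invEuler, hn]

lemma tendsto_tripleCoeff {p : K} (hp : ‖p‖ < 1) (k : ℤ) :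
    Tendsto (fun N => tripleCoeff p N k) atTop (𝓝 (euler (p ^ 2))⁻¹) := by
  have hx := norm_sq_lt_one hp
  have h1 : Tendsto (fun N : ℕ => 2 * N) atTop atTop :=
    tendsto_id.const_mul_atTop' two_pos
  have hN : Tendsto (fun N : ℕ => (N : ℤ)) atTop atTop := tendsto_natCast_atTop_atTop
  have h2 := tendsto_atTop_add_const_right _ k hN
  have h3 := tendsto_atTop_add_const_right _ (-k) hN
  have := (((tendsto_eulerFin hx).comp h1).mul ((tendsto_invEuler hx).comp h2)).mul
    ((tendsto_invEuler hx).comp h3)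
  rw [mul_inv_cancel₀ (euler_ne_zero hx), one_mul] at this
  exact this

lemma exists_bound_tripleCoeff {p : K} (hp : ‖p‖ < 1) :
    ∃ C, 0 ≤ C ∧ ∀ N k, ‖tripleCoeff p N k‖ ≤ C := by
  have hx := norm_sq_lt_one hp
  obtain ⟨C₁, h₁⟩ := exists_bound_eulerFin hx
  obtain ⟨C₂, h₂⟩ := exists_bound_invEuler hx
  have hC₁ := (norm_nonneg _).trans (h₁ 0)
  have hC₂ := (norm_nonneg _).trans (h₂ 0)
  refine ⟨C₁ * C₂ * C₂, by positivity, fun N k => ?_⟩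
  rw [tripleCoeff, norm_mul, norm_mul]
  gcongr
  exacts [h₁ _, h₂ _, h₂ _]

/-- Passage to the limit in sums against the coefficients of the finite triple product. -/
lemma tendsto_tsum_tripleCoeff {p z : K} (hp0 : p ≠ 0) (hp : ‖p‖ < 1) (hz : z ≠ 0) {w : ℤ → K}
    (j : ℕ) (hw : ∀ k, ‖w k‖ ≤ (|k| : ℝ) ^ j) :
    Tendsto (fun N => ∑' k : ℤ, w k * (tripleCoeff p N k * p ^ (k ^ 2) * z ^ k)) atTop
      (𝓝 ((euler (p ^ 2))⁻¹ * ∑' k : ℤ, w k * (p ^ (k ^ 2) * z ^ k))) := by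
  obtain ⟨C, hC0, hC⟩ := exists_bound_tripleCoeff hp
  rw [← tsum_mul_left]
  refine tendsto_tsum_of_dominated_convergence
    ((summable_abs_pow_mul_gaussian hp0 hp hz j).mul_left C) (fun k => ?_) (.of_forall fun N k => ?_)
  · have := ((tendsto_tripleCoeff hp k).mul_const (w k * (p ^ (k ^ 2) * z ^ k)))
    exact this.congr fun N => by ring
  · rw [norm_mul, norm_mul, norm_mul, norm_zpow, norm_zpow]
    calc _ = ‖tripleCoeff p N k‖ * (‖w k‖ * (‖p‖ ^ (k ^ 2) * ‖z‖ ^ k)) := by ring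
      _ ≤ _ := by
        gcongr
        exacts [hC N k, hw k]

lemma tendsto_tripleFin {p : K} (hp : ‖p‖ < 1) (z : K) :
    Tendsto (tripleFin p z) atTop
      (𝓝 ((∏' n : ℕ, (1 + z * p ^ (2 * n + 1))) * ∏' n : ℕ, (1 + z⁻¹ * p ^ (2 * n + 1)))) := by
  have h1 := multipliable_one_add_const_mul_pow hp z two_pos 1
  have h2 := multipliable_one_add_const_mul_pow hp z⁻¹ two_pos 1
  refine (h1.tendsto_prod_tprod_nat.mul h2.tendsto_prod_tprod_nat).congr fun N => ?_
  rw [tripleFin, Finset.prod_mul_distrib]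

/-- **Jacobi's triple product identity.** -/
theorem tsum_triple_product {p z : K} (hp0 : p ≠ 0) (hp : ‖p‖ < 1) (hz : z ≠ 0) :
    ∑' k : ℤ, p ^ (k ^ 2) * z ^ k = euler (p ^ 2) *
      ((∏' n : ℕ, (1 + z * p ^ (2 * n + 1))) * ∏' n : ℕ, (1 + z⁻¹ * p ^ (2 * n + 1))) := by
  have h := tendsto_tsum_tripleCoeff hp0 hp hz (w := 1) 0 (by simp)
  simp only [Pi.one_apply, one_mul, (hasSum_tripleFin hp0 hp hz _).tsum_eq] at h
  rw [tendsto_nhds_unique (tendsto_tripleFin hp z) h, mul_inv_cancel_left₀]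
  exact euler_ne_zero (norm_sq_lt_one hp)

/-- **Jacobi's identity** for the cube of the Euler product. -/
theorem tsum_mul_eq_euler_cube {p : K} (hp0 : p ≠ 0) (hp : ‖p‖ < 1)
    (hint : ∀ k : ℤ, ‖(k : K)‖ ≤ |(k : ℝ)|) :
    ∑' k : ℤ, (k : K) * (p ^ (k ^ 2) * (-p) ^ k) = euler (p ^ 2) ^ 3 := by
  have hx := norm_sq_lt_one hp
  have h := (tendsto_tsum_tripleCoeff hp0 hp (neg_ne_zero.2 hp0) (w := fun k => k) 1
    (by simpa using hint)).comp (tendsto_add_atTop_nat 1)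
  have h2 : Tendsto (fun N => eulerFin (p ^ 2) (N + 1) * eulerFin (p ^ 2) N) atTop
      (𝓝 (euler (p ^ 2) * euler (p ^ 2))) :=
    ((tendsto_eulerFin hx).comp (tendsto_add_atTop_nat 1)).mul (tendsto_eulerFin hx)
  have h3 := tendsto_nhds_unique (h2.congr fun N => ?_) h
  · have := euler_ne_zero hx
    field_simp at h3
    simpa only [mul_assoc] using h3.symm
  · simpa using (hasSum_mul_tripleFin hp0 hp N).tsum_eq.symm

end TripleProductLimit

/-! ### Convergents, their errors, and the limit at `q = 1`. -/

section ContinuedFraction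

lemma contFract_get (q : ℝ) (n : ℕ) : (contFract q).s.get? n =
    some ⟨if n = 0 then q ^ (1 / 5 : ℝ) else q ^ n, 1⟩ := rfl

lemma contFract_nums_zero (q : ℝ) : (contFract q).nums 0 = 0 := rfl

lemma contFract_dens_zero (q : ℝ) : (contFract q).dens 0 = 1 := rfl

lemma contFract_nums_one (q : ℝ) : (contFract q).nums 1 = q ^ (1 / 5 : ℝ) := by
  rw [GenContFract.first_num_eq (contFract_get q 0)]; simp [contFract]

lemma contFract_dens_one (q : ℝ) : (contFract q).dens 1 = 1 := by
  rw [GenContFract.first_den_eq (contFract_get q 0)]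

lemma contFract_nums_add_two (q : ℝ) (n : ℕ) : (contFract q).nums (n + 2) =
    (contFract q).nums (n + 1) + q ^ (n + 1) * (contFract q).nums n := by
  rw [GenContFract.nums_recurrence (contFract_get q (n + 1)) rfl rfl]; simp

lemma contFract_dens_add_two (q : ℝ) (n : ℕ) : (contFract q).dens (n + 2) =
    (contFract q).dens (n + 1) + q ^ (n + 1) * (contFract q).dens n := by
  rw [GenContFract.dens_recurrence (contFract_get q (n + 1)) rfl rfl]; simp

lemma one_le_contFract_dens {q : ℝ} (hq : 0 < q) (n : ℕ) : 1 ≤ (contFract q).dens n := by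
  induction n using Nat.twoStepInduction with
  | zero => rw [contFract_dens_zero]
  | one => rw [contFract_dens_one]
  | more n h1 h2 =>
    rw [contFract_dens_add_two]
    have : 0 ≤ q ^ (n + 1) * (contFract q).dens n := by positivity
    linarith

/-- A positive solution of the three-term recurrence attached to the continued fraction. -/
structure IsTail (q : ℝ) (y : ℕ → ℝ) : Prop where
  pos : ∀ n, 0 < y n
  eq_add : ∀ n, y n = y (n + 1) + q ^ (n + 1) * y (n + 2)

variable {q : ℝ} {y : ℕ → ℝ}

/-- The error of a convergent, multiplied by its denominator. -/
noncomputable def contFractError (q L : ℝ) (n : ℕ) : ℝ :=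
  (contFract q).nums n - L * (contFract q).dens n

lemma contFractError_zero (q L : ℝ) : contFractError q L 0 = -L := by
  simp [contFractError, contFract]

/-- Errors obey the forward recurrence of the convergents. If the formula holds at `n`, then `e
(n+2) = e (n+1) (1 - y (n+1) / y (n+2))`, and the tail recurrence rewrites the bracket. -/
lemma IsTail.error_succ (h : IsTail q y) (n : ℕ) :
    contFractError q (q ^ (1 / 5 : ℝ) * (y 1 / y 0)) (n + 1) =
      -(q ^ (n + 1) * (y (n + 2) / y (n + 1))) *
        contFractError q (q ^ (1 / 5 : ℝ) * (y 1 / y 0)) n := by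
  have hp := fun n => (h.pos n).ne'
  induction n with
  | zero =>
    simp only [contFractError, zero_add, contFract_nums_one, contFract_dens_one,
      contFract_nums_zero, contFract_dens_zero, pow_one]
    have r := h.eq_add 0
    have := hp 0
    have := hp 1
    simp only [zero_add, pow_one] at r
    field_simp
    rw [r]
    ring
  | succ n ih =>
    have r := h.eq_add (n + 1)
    have := hp (n + 1)
    have := hp (n + 2)
    set L := q ^ (1 / 5 : ℝ) * (y 1 / y 0)
    have e : contFractError q L (n + 2) =
        contFractError q L (n + 1) + q ^ (n + 1) * contFractError q L n := by
      simp only [contFractError, contFract_nums_add_two, contFract_dens_add_two]; ring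
    rw [show n + 1 + 1 = n + 2 from rfl, e, ih]
    field_simp
    rw [r]
    ring

/-- The multiplier in `error_succ` is negative, so errors alternate in sign, starting from `-L < 0`.
-/
lemma IsTail.error_pos (h : IsTail q y) (hq : 0 < q) (n : ℕ) :
    0 < (-1) ^ (n + 1) * contFractError q (q ^ (1 / 5 : ℝ) * (y 1 / y 0)) n := by
  have hp := h.pos
  induction n with
  | zero =>
    have := hp 0
    have := hp 1
    rw [contFractError_zero]
    simp only [zero_add, pow_one, neg_mul, one_mul, neg_neg]
    positivity
  | succ n ih =>
    rw [h.error_succ]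
    have := hp (n + 1)
    have := hp (n + 2)
    have e : 0 < q ^ (n + 1) * (y (n + 2) / y (n + 1)) := by positivity
    have := mul_pos e ih
    rw [pow_succ]
    linarith

lemma convs_sub_eq (hq : 0 < q) (L : ℝ) (n : ℕ) :
    (contFract q).convs n - L = contFractError q L n / (contFract q).dens n := by
  have := one_le_contFract_dens hq n
  rw [GenContFract.conv_eq_num_div_den, contFractError]
  field_simp

lemma IsTail.convs_lt (h : IsTail q y) (hq : 0 < q) (n : ℕ) :
    (contFract q).convs (2 * n) < q ^ (1 / 5 : ℝ) * (y 1 / y 0) := by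
  rw [← sub_neg, convs_sub_eq hq]
  have := one_le_contFract_dens hq (2 * n)
  refine div_neg_of_neg_of_pos ?_ (by linarith)
  simpa [pow_succ, pow_mul] using h.error_pos hq (2 * n)

lemma IsTail.lt_convs (h : IsTail q y) (hq : 0 < q) (n : ℕ) :
    q ^ (1 / 5 : ℝ) * (y 1 / y 0) < (contFract q).convs (2 * n + 1) := by
  rw [← sub_pos, convs_sub_eq hq]
  have := one_le_contFract_dens hq (2 * n + 1)
  refine div_pos ?_ (by linarith)
  simpa [pow_succ, pow_mul] using h.error_pos hq (2 * n + 1)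

/-- The convergents tend to the ratio of the first two terms of a tail sequence, provided the
partial ratios are eventually bounded away from one. -/
lemma IsTail.tendsto_convs (h : IsTail q y) (hq : 0 < q) {r : ℝ} (hr : r < 1)
    (hy : ∀ᶠ n in atTop, q ^ (n + 1) * (y (n + 2) / y (n + 1)) ≤ r) :
    Tendsto (fun n => (contFract q).convs n) atTop (𝓝 (q ^ (1 / 5 : ℝ) * (y 1 / y 0))) := by
  set L := q ^ (1 / 5 : ℝ) * (y 1 / y 0)
  have h0 : Tendsto (contFractError q L) atTop (𝓝 0) := by
    obtain ⟨N, hN⟩ := eventually_atTop.1 hy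
    have hr0 : 0 ≤ r := le_trans (by
      have := h.pos (N + 1)
      have := h.pos (N + 2)
      positivity) (hN N le_rfl)
    have hb : ∀ n, |contFractError q L (n + N)| ≤ r ^ n * |contFractError q L N| := by
      intro n
      induction n with
      | zero => simp
      | succ n ih =>
        rw [show n + 1 + N = n + N + 1 by ring, h.error_succ, abs_mul, abs_neg, pow_succ r,
          mul_comm _ r, mul_assoc r]
        have := h.pos (n + N + 1)
        have := h.pos (n + N + 2)
        rw [abs_of_pos (by positivity)]
        exact mul_le_mul (hN _ (by omega)) ih (abs_nonneg _) hr0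
    refine (tendsto_add_atTop_iff_nat N).1 (squeeze_zero_norm hb ?_)
    simpa using (tendsto_pow_atTop_nhds_zero_of_lt_one hr0 hr).mul_const |contFractError q L N|
  rw [tendsto_iff_norm_sub_tendsto_zero]
  refine squeeze_zero (fun _ => norm_nonneg _) (fun n => ?_) (tendsto_norm_zero.comp h0)
  rw [convs_sub_eq hq, norm_div]
  have := one_le_contFract_dens hq n
  refine div_le_self (norm_nonneg _) ?_
  rw [Real.norm_of_nonneg (by linarith)]
  exact this

lemma IsTail.R_eq (h : IsTail q y) (hq : 0 < q) {r : ℝ} (hr : r < 1)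
    (hy : ∀ᶠ n in atTop, q ^ (n + 1) * (y (n + 2) / y (n + 1)) ≤ r) :
    R q = q ^ (1 / 5 : ℝ) * (y 1 / y 0) :=
  (h.tendsto_convs hq hr hy).limUnder_eq

lemma rMax_pos : 0 < rMax := by
  have : (1 : ℝ) < √5 := by rw [Real.lt_sqrt] <;> norm_num
  unfold rMax; linarith

lemma rMax_lt_one : rMax < 1 := by
  have : √5 < (3 : ℝ) := by rw [Real.sqrt_lt] <;> norm_num
  unfold rMax; linarith

lemma rMax_add_sq : rMax + rMax ^ 2 = 1 := by
  have : √5 ^ 2 = (5 : ℝ) := Real.sq_sqrt (by norm_num)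
  unfold rMax; linear_combination this / 4

/-- At `q = 1` the recurrence has constant coefficients, and `ρ + ρ² = 1` makes `ρ^n` its decaying
solution. -/
lemma isTail_one : IsTail 1 (fun n => rMax ^ n) where
  pos n := pow_pos rMax_pos n
  eq_add n := by linear_combination (-(rMax ^ n)) * rMax_add_sq

lemma eventually_ratio_one :
    ∀ᶠ n in atTop, (1 : ℝ) ^ (n + 1) * (rMax ^ (n + 2) / rMax ^ (n + 1)) ≤ rMax := by
  refine .of_forall fun n => ?_
  have := rMax_pos
  rw [pow_succ rMax (n + 1)]
  field_simp
  simp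

lemma R_one : R 1 = rMax := by
  simpa using isTail_one.R_eq one_pos rMax_lt_one eventually_ratio_one

lemma tendsto_convs_one : Tendsto (fun n => (contFract 1).convs n) atTop (𝓝 rMax) := by
  simpa using isTail_one.tendsto_convs one_pos rMax_lt_one eventually_ratio_one

lemma continuousAt_nums_dens (n : ℕ) {q : ℝ} (hq : 0 < q) :
    ContinuousAt (fun q => (contFract q).nums n) q ∧
      ContinuousAt (fun q => (contFract q).dens n) q := by
  induction n using Nat.twoStepInduction with
  | zero =>
    simp only [contFract_nums_zero, contFract_dens_zero]
    exact ⟨continuousAt_const, continuousAt_const⟩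
  | one =>
    simp only [contFract_nums_one, contFract_dens_one]
    exact ⟨Real.continuousAt_rpow_const _ _ (.inl hq.ne'), continuousAt_const⟩
  | more n h1 h2 =>
    obtain ⟨h1, h1'⟩ := h1
    obtain ⟨h2, h2'⟩ := h2
    simp only [contFract_nums_add_two, contFract_dens_add_two]
    exact ⟨by fun_prop, by fun_prop⟩

lemma continuousAt_convs (n : ℕ) {q : ℝ} (hq : 0 < q) :
    ContinuousAt (fun q => (contFract q).convs n) q := by
  obtain ⟨h1, h2⟩ := continuousAt_nums_dens n hq
  have := one_le_contFract_dens hq n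
  simp only [GenContFract.conv_eq_num_div_den]
  exact h1.div h2 (by positivity)

/-- A function lying between consecutive convergents for `q < 1` tends to `rMax` as `q → 1`. -/
lemma tendsto_of_between_convs {f : ℝ → ℝ}
    (h1 : ∀ n, ∀ q ∈ Set.Ioo (0 : ℝ) 1, (contFract q).convs (2 * n) < f q)
    (h2 : ∀ n, ∀ q ∈ Set.Ioo (0 : ℝ) 1, f q < (contFract q).convs (2 * n + 1)) :
    Tendsto f (𝓝[<] 1) (𝓝 rMax) := by
  have hev : ∀ᶠ q : ℝ in 𝓝[<] 1, q ∈ Set.Ioo (0 : ℝ) 1 := Ioo_mem_nhdsLT one_pos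
  have hc : ∀ n, Tendsto (fun q => (contFract q).convs n) (𝓝[<] 1)
      (𝓝 ((contFract 1).convs n)) := fun n => (continuousAt_convs n one_pos).mono_left
        nhdsWithin_le_nhds
  have t0 : Tendsto (fun n : ℕ => 2 * n) atTop atTop := tendsto_id.const_mul_atTop' two_pos
  rw [tendsto_order]
  constructor
  -- One convergent at `q = 1` already exceeds `a`; being continuous in `q`, it does so near `1` as
  -- well. No uniformity in `n` is needed.
  · intro a ha
    obtain ⟨n, hn⟩ := ((tendsto_convs_one.comp t0).eventually (lt_mem_nhds ha)).exists
    filter_upwards [hev, (hc (2 * n)).eventually (lt_mem_nhds hn)] with q hq hq2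
    exact hq2.trans (h1 n q hq)
  · intro a ha
    obtain ⟨n, hn⟩ := ((tendsto_convs_one.comp ((tendsto_add_atTop_nat 1).comp t0)).eventually
      (gt_mem_nhds ha)).exists
    filter_upwards [hev, (hc (2 * n + 1)).eventually (gt_mem_nhds (show _ < a from hn))] with q hq hq2
    exact (h2 n q hq).trans hq2

end ContinuedFraction

/-! ### Rogers' series solve the recurrence of the continued fraction. -/

section TailSeries

variable {p : ℝ}

lemma eulerFin_pos {x : ℝ} (hx0 : 0 ≤ x) (hx1 : x < 1) (n : ℕ) : 0 < eulerFin x n :=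
  Finset.prod_pos fun i _ => sub_pos.2 (pow_lt_one₀ hx0 hx1 (by simp))

lemma eulerFin_le_one {x : ℝ} (hx0 : 0 ≤ x) (hx1 : x < 1) (n : ℕ) : eulerFin x n ≤ 1 :=
  Finset.prod_le_one (fun i _ => sub_nonneg.2 (pow_le_one₀ hx0 hx1.le)) fun i _ =>
    sub_le_self _ (by positivity)

lemma euler_pos {x : ℝ} (hx0 : 0 ≤ x) (hx1 : x < 1) : 0 < euler x := by
  have hx : ‖x‖ < 1 := by rwa [Real.norm_of_nonneg hx0]
  exact lt_of_le_of_ne (ge_of_tendsto' (tendsto_eulerFin hx) fun n => (eulerFin_pos hx0 hx1 n).le)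
    (euler_ne_zero hx).symm

/-- The quotient `(x; x)_{k+r} / (x; x)_r` with `x = p²`. -/
noncomputable def eulerRatio (p : ℝ) (k r : ℕ) : ℝ :=
  eulerFin (p ^ 2) (k + r) / eulerFin (p ^ 2) r

/-- The terms of Rogers' series for the numerators in the tails of the continued fraction. -/
noncomputable def tailTerm (p : ℝ) (k r : ℕ) : ℝ :=
  (-1) ^ r * p ^ (5 * r ^ 2 + r + 4 * r * k) * (1 - p ^ (4 * k + 4 + 8 * r)) * eulerRatio p k r

/-- An alternative form of the terms of Rogers' series. -/
noncomputable def tailTerm' (p : ℝ) (k r : ℕ) : ℝ :=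
  (-1) ^ r * p ^ (5 * r ^ 2 + 3 * r + 4 * r * k) * (1 - p ^ (2 * k + 2 + 4 * r)) * eulerRatio p k r

/-- Rogers' series. -/
noncomputable def tailSeries (p : ℝ) (k : ℕ) : ℝ := ∑' r, tailTerm p k r

lemma exists_bound_eulerRatio (hp0 : 0 < p) (hp1 : p < 1) :
    ∃ C, 0 ≤ C ∧ ∀ k r, |eulerRatio p k r| ≤ C := by
  have hx1 : p ^ 2 < 1 := pow_lt_one₀ hp0.le hp1 two_ne_zero
  have hx0 : 0 ≤ p ^ 2 := by positivity
  obtain ⟨C, hC⟩ := exists_bound_invEuler (x := p ^ 2) (by rwa [Real.norm_of_nonneg hx0])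
  refine ⟨C, (norm_nonneg _).trans (hC 0), fun k r => ?_⟩
  have h1 := hC r
  rw [invEuler_natCast, Real.norm_eq_abs] at h1
  rw [eulerRatio, div_eq_mul_inv, abs_mul, abs_of_pos (eulerFin_pos hx0 hx1 _)]
  exact (mul_le_of_le_one_left (abs_nonneg _) (eulerFin_le_one hx0 hx1 _)).trans h1

lemma abs_term_le (hp0 : 0 < p) (hp1 : p < 1) {C : ℝ}
    (hC : ∀ k r, |eulerRatio p k r| ≤ C) {r N M : ℕ} (h : r ≤ N) (k : ℕ) :
    |(-1) ^ r * p ^ N * (1 - p ^ M) * eulerRatio p k r| ≤ p ^ r * C := by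
  rw [abs_mul, abs_mul, abs_mul, abs_pow, abs_neg, abs_one, one_pow, one_mul,
    abs_of_pos (pow_pos hp0 _)]
  have h1 : p ^ M ≤ 1 := pow_le_one₀ hp0.le hp1.le
  have h2 : 0 < p ^ M := pow_pos hp0 _
  have h3 : |1 - p ^ M| ≤ 1 := by rw [abs_le]; constructor <;> linarith
  have h4 : p ^ N ≤ p ^ r := pow_le_pow_of_le_one hp0.le hp1.le h
  calc p ^ N * |1 - p ^ M| * |eulerRatio p k r| ≤ p ^ r * 1 * C := by
        gcongr
        exact hC k r
    _ = _ := by ring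

lemma summable_term (hp0 : 0 < p) (hp1 : p < 1) (k : ℕ) {N M : ℕ → ℕ} (h : ∀ r, r ≤ N r) :
    Summable fun r => (-1) ^ r * p ^ N r * (1 - p ^ M r) * eulerRatio p k r := by
  obtain ⟨C, -, hC⟩ := exists_bound_eulerRatio hp0 hp1
  exact ((summable_geometric_of_lt_one hp0.le hp1).mul_right C).of_norm_bounded
    fun r => abs_term_le hp0 hp1 hC (h r) k

lemma summable_tailTerm (hp0 : 0 < p) (hp1 : p < 1) (k : ℕ) : Summable (tailTerm p k) :=
  summable_term hp0 hp1 k fun r => by nlinarith [Nat.zero_le (4 * r * k), Nat.zero_le (r ^ 2)]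

lemma summable_tailTerm' (hp0 : 0 < p) (hp1 : p < 1) (k : ℕ) : Summable (tailTerm' p k) :=
  summable_term hp0 hp1 k fun r => by nlinarith [Nat.zero_le (4 * r * k), Nat.zero_le (r ^ 2)]

lemma tsum_eq_of_telescope {f g v : ℕ → ℝ} (hf : Summable f) (hg : Summable g) (hv : Summable v)
    (h0 : v 0 = 0) (h : ∀ r, f r - g r = v r - v (r + 1)) : ∑' r, f r = ∑' r, g r := by
  rw [← sub_eq_zero, ← hf.tsum_sub hg, tsum_congr h,
    hv.tsum_sub ((summable_nat_add_iff 1).2 hv), hv.tsum_eq_zero_add, h0]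
  ring

lemma eulerRatio_succ_succ (hp0 : 0 < p) (hp1 : p < 1) (k r : ℕ) :
    (1 - p ^ (2 * (r + 1))) * eulerRatio p k (r + 1) =
      (1 - p ^ (2 * (k + r + 1))) * eulerRatio p k r := by
  have hx1 : p ^ 2 < 1 := pow_lt_one₀ hp0.le hp1 two_ne_zero
  have h1 := (eulerFin_pos (by positivity) hx1 r).ne'
  have h2 := (eulerFin_pos (by positivity) hx1 (r + 1)).ne'
  rw [eulerFin_succ, ← pow_mul] at h2
  have h3 := right_ne_zero_of_mul h2
  rw [eulerRatio, eulerRatio, ← add_assoc, eulerFin_succ, eulerFin_succ, ← pow_mul, ← pow_mul]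
  field_simp

lemma eulerRatio_succ (k r : ℕ) :
    eulerRatio p (k + 1) r = (1 - p ^ (2 * (k + r + 1))) * eulerRatio p k r := by
  rw [eulerRatio, eulerRatio, show k + 1 + r = k + r + 1 by ring, eulerFin_succ, ← pow_mul]
  ring

/-- The difference of the two series telescopes. The factor `1 - p^(2r)` of `v` kills the term at `r
= 0` and, at `r + 1`, lowers `eulerRatio` back to index `r`. -/
lemma tailSeries_succ (hp0 : 0 < p) (hp1 : p < 1) (k : ℕ) :
    tailSeries p (k + 1) = ∑' r, tailTerm' p k r := by
  symm
  refine tsum_eq_of_telescope (v := fun r => (-1) ^ r * p ^ (5 * r ^ 2 + 3 * r + 4 * r * k) *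
    (1 - p ^ (2 * r)) * eulerRatio p k r) (summable_tailTerm' hp0 hp1 k)
    (summable_tailTerm hp0 hp1 (k + 1)) (summable_term hp0 hp1 k fun r => by
      nlinarith [Nat.zero_le (4 * r * k), Nat.zero_le (r ^ 2)]) (by simp) fun r => ?_
  have h := eulerRatio_succ_succ hp0 hp1 k r
  rw [mul_assoc _ (1 - p ^ (2 * (r + 1))), h, tailTerm, tailTerm', eulerRatio_succ]
  ring

/-- Both series on the right are taken in their alternative form, so all three involve `eulerRatio p
k`; the telescoping is then as in `tailSeries_succ`. -/
lemma tailSeries_eq_add (hp0 : 0 < p) (hp1 : p < 1) (k : ℕ) :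
    tailSeries p k = tailSeries p (k + 1) + (p ^ 2) ^ (k + 1) * tailSeries p (k + 2) := by
  rw [tailSeries_succ hp0 hp1 k, tailSeries_succ hp0 hp1 (k + 1), ← tsum_mul_left,
    ← (summable_tailTerm' hp0 hp1 k).tsum_add ((summable_tailTerm' hp0 hp1 (k + 1)).mul_left _)]
  refine tsum_eq_of_telescope (v := fun r => (-1) ^ r * p ^ (5 * r ^ 2 + r + 4 * r * k) *
    (1 - p ^ (2 * r)) * eulerRatio p k r) (summable_tailTerm hp0 hp1 k)
    ((summable_tailTerm' hp0 hp1 k).add ((summable_tailTerm' hp0 hp1 (k + 1)).mul_left _))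
    (summable_term hp0 hp1 k fun r => by
      nlinarith [Nat.zero_le (4 * r * k), Nat.zero_le (r ^ 2)]) (by simp) fun r => ?_
  have h := eulerRatio_succ_succ hp0 hp1 k r
  rw [mul_assoc _ (1 - p ^ (2 * (r + 1))), h, tailTerm, tailTerm', tailTerm', eulerRatio_succ]
  ring

/-- Every term with `r ≥ 1` carries `p^(4rk)` and dies; the term `r = 0` tends to the Euler product.
-/
lemma tendsto_tailSeries (hp0 : 0 < p) (hp1 : p < 1) :
    Tendsto (tailSeries p) atTop (𝓝 (euler (p ^ 2))) := by
  obtain ⟨C, hC0, hC⟩ := exists_bound_eulerRatio hp0 hp1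
  have hx1 : p ^ 2 < 1 := pow_lt_one₀ hp0.le hp1 two_ne_zero
  have hx : ‖p ^ 2‖ < 1 := by rwa [Real.norm_of_nonneg (by positivity)]
  have hpow : ∀ c : ℕ, 0 < c → ∀ d : ℕ, Tendsto (fun k : ℕ => p ^ (c * k + d)) atTop (𝓝 0) := by
    intro c hc d
    refine (tendsto_pow_atTop_nhds_zero_of_lt_one hp0.le hp1).comp ?_
    exact tendsto_atTop_mono (fun k => by simp only [id]; nlinarith) tendsto_id
  have key := tendsto_tsum_of_dominated_convergence (𝓕 := atTop) (f := tailTerm p)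
    (g := fun r => if r = 0 then euler (p ^ 2) else 0)
    ((summable_geometric_of_lt_one hp0.le hp1).mul_right C) (fun r => ?_)
    (.of_forall fun k r => abs_term_le hp0 hp1 hC
      (by nlinarith [Nat.zero_le (4 * r * k), Nat.zero_le (r ^ 2)]) k)
  · rwa [tsum_ite_eq] at key
  · rcases Nat.eq_zero_or_pos r with rfl | hr
    · have := ((hpow 4 (by norm_num) 4).const_sub 1).mul (tendsto_eulerFin hx)
      simpa [tailTerm, eulerRatio, eulerFin] using this
    · rw [if_neg hr.ne']
      refine squeeze_zero_norm (a := fun k => p ^ (1 * k + 0) * C) (fun k => ?_) ?_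
      · rw [tailTerm]
        have h1 : k ≤ 5 * r ^ 2 + r + 4 * r * k := by nlinarith [Nat.zero_le (r ^ 2)]
        have e : ∀ N M : ℕ, k ≤ N → ‖(-1 : ℝ) ^ r * p ^ N * (1 - p ^ M) * eulerRatio p k r‖ ≤
            p ^ (1 * k + 0) * C := by
          intro N M hN
          rw [Real.norm_eq_abs, abs_mul, abs_mul, abs_mul, abs_pow, abs_neg, abs_one, one_pow,
            one_mul, abs_of_pos (pow_pos hp0 _), mul_assoc]
          have h3 : |1 - p ^ M| ≤ 1 := by
            have h1 : p ^ M ≤ 1 := pow_le_one₀ hp0.le hp1.le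
            have h2 : 0 < p ^ M := pow_pos hp0 _
            rw [abs_le]; constructor <;> linarith
          have h4 : p ^ N ≤ p ^ (1 * k + 0) := pow_le_pow_of_le_one hp0.le hp1.le (by omega)
          refine mul_le_mul h4 ?_ (by positivity) (by positivity)
          exact (mul_le_of_le_one_left (abs_nonneg _) h3).trans (hC k r)
        exact e _ _ h1
      · simpa using (hpow 1 one_pos 0).mul_const C

lemma isTail_tailSeries (hp0 : 0 < p) (hp1 : p < 1) : IsTail (p ^ 2) (tailSeries p) where
  pos n := by
    have hx1 : p ^ 2 < 1 := pow_lt_one₀ hp0.le hp1 two_ne_zero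
    obtain ⟨N, hN⟩ := eventually_atTop.1 ((tendsto_tailSeries hp0 hp1).eventually
      (lt_mem_nhds (euler_pos (by positivity) hx1)))
    by_cases hn : N ≤ n
    · exact hN n hn
    -- Terms are positive from `N` on because the limit is; the recurrence has positive coefficients
    -- and propagates positivity downwards.
    · have : ∀ j, ∀ m, N ≤ m + j → 0 < tailSeries p m := by
        intro j
        induction j using Nat.strong_induction_on with
        | _ j ih =>
          intro m hm
          by_cases h : N ≤ m
          · exact hN m h
          · rw [tailSeries_eq_add hp0 hp1]
            have h1 := ih (j - 1) (by omega) (m + 1) (by omega)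
            have h2 := ih (j - 1) (by omega) (m + 2) (by omega)
            positivity
      exact this N n (by omega)
  eq_add := tailSeries_eq_add hp0 hp1

lemma R_sq_eq (hp0 : 0 < p) (hp1 : p < 1) :
    R (p ^ 2) = (p ^ 2) ^ (1 / 5 : ℝ) * (tailSeries p 1 / tailSeries p 0) := by
  have hx1 : p ^ 2 < 1 := pow_lt_one₀ hp0.le hp1 two_ne_zero
  -- The ratios tend to `0`, so any bound in `(0, 1)` would serve.
  refine (isTail_tailSeries hp0 hp1).R_eq (by positivity) (r := 1 / 2) (by norm_num) ?_
  have t := tendsto_tailSeries hp0 hp1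
  have t1 := (tendsto_pow_atTop_nhds_zero_of_lt_one (by positivity) hx1).comp
    (tendsto_add_atTop_nat 1)
  have t2 := (t.comp (tendsto_add_atTop_nat 2)).div (t.comp (tendsto_add_atTop_nat 1))
    (euler_pos (by positivity) hx1).ne'
  have := t1.mul t2
  rw [zero_mul] at this
  exact this.eventually (ge_mem_nhds (by norm_num))

end TailSeries

/-! ### Theta series, their products, and `R` as a theta quotient. -/

section AlternatingTheta

/-- The general term of an alternating theta series. -/
noncomputable def thetaTerm (s b : ℝ) (n : ℤ) : ℝ := (-1) ^ n * Real.exp (-s * (n + b) ^ 2)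

/-- The alternating theta series `∑ (-1)^n exp (-s (n + b)²)`. -/
noncomputable def altTheta (s b : ℝ) : ℝ := ∑' n : ℤ, thetaTerm s b n

lemma thetaTerm_eq (s b : ℝ) (n : ℤ) : thetaTerm s b n = Real.exp (-s * b ^ 2) *
    (Real.exp (-s) ^ (n ^ 2) * (-Real.exp (-2 * s * b)) ^ n) := by
  rw [neg_eq_neg_one_mul (Real.exp (-2 * s * b)), mul_zpow, thetaTerm,
    ← Real.rpow_intCast (Real.exp (-s)), ← Real.rpow_intCast (Real.exp (-2 * s * b)),
    ← Real.exp_mul, ← Real.exp_mul, mul_left_comm (Real.exp _) ((-1) ^ n),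
    mul_left_comm (Real.exp _) ((-1) ^ n), ← Real.exp_add, ← Real.exp_add]
  push_cast
  ring_nf

lemma norm_thetaTerm (s b : ℝ) (n : ℤ) : ‖thetaTerm s b n‖ = Real.exp (-s * (n + b) ^ 2) := by
  rw [thetaTerm, norm_mul, norm_zpow, norm_neg, norm_one, one_zpow, one_mul,
    Real.norm_of_nonneg (Real.exp_nonneg _)]

lemma exp_neg_lt_one {s : ℝ} (hs : 0 < s) : Real.exp (-s) < 1 := by
  rw [← Real.exp_zero]; exact Real.exp_lt_exp.2 (by linarith)

lemma norm_exp_neg_lt_one {s : ℝ} (hs : 0 < s) : ‖Real.exp (-s)‖ < 1 := by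
  rw [Real.norm_of_nonneg (Real.exp_nonneg _)]; exact exp_neg_lt_one hs

lemma summable_norm_thetaTerm {s : ℝ} (hs : 0 < s) (b : ℝ) :
    Summable fun n => ‖thetaTerm s b n‖ := by
  have h := (summable_abs_pow_mul_gaussian (Real.exp_ne_zero (-s)) (norm_exp_neg_lt_one hs)
    (z := -Real.exp (-2 * s * b)) (neg_ne_zero.2 (Real.exp_ne_zero _)) 0).mul_left
      (Real.exp (-s * b ^ 2))
  refine h.congr fun n => ?_
  rw [thetaTerm_eq, norm_mul, norm_mul, norm_zpow, norm_zpow,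
    Real.norm_of_nonneg (Real.exp_nonneg (-s * b ^ 2)), pow_zero, one_mul]

lemma summable_thetaTerm {s : ℝ} (hs : 0 < s) (b : ℝ) : Summable (thetaTerm s b) :=
  (summable_norm_thetaTerm hs b).of_norm

/-- The product `∏ (1 - exp (-(c n + a)))`. -/
noncomputable def expProd (c a : ℝ) : ℝ := ∏' n : ℕ, (1 - Real.exp (-(c * n + a)))

lemma exp_neg_pow (u : ℝ) (k : ℕ) : Real.exp (-u) ^ k = Real.exp (-(k * u)) := by
  rw [← Real.exp_nat_mul]; ring_nf

lemma euler_exp (u : ℝ) : euler (Real.exp (-u)) = expProd u u := by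
  refine tprod_congr fun n => ?_
  rw [exp_neg_pow]; push_cast; ring_nf

lemma altTheta_eq_prod {s : ℝ} (hs : 0 < s) (b : ℝ) :
    altTheta s b = Real.exp (-s * b ^ 2) * (expProd (2 * s) (2 * s) *
      (expProd (2 * s) (s + 2 * s * b) * expProd (2 * s) (s - 2 * s * b))) := by
  rw [altTheta, tsum_congr (thetaTerm_eq s b), tsum_mul_left, tsum_triple_product
    (Real.exp_ne_zero (-s)) (norm_exp_neg_lt_one hs) (neg_ne_zero.2 (Real.exp_ne_zero _)),
    exp_neg_pow, euler_exp]
  push_cast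
  congr 3
  · refine tprod_congr fun n => ?_
    rw [← Real.exp_nat_mul, neg_mul, ← Real.exp_add, ← sub_eq_add_neg]
    push_cast; ring_nf
  · refine tprod_congr fun n => ?_
    rw [← Real.exp_nat_mul, inv_neg, neg_mul, ← Real.exp_neg, ← Real.exp_add, ← sub_eq_add_neg]
    push_cast; ring_nf

/-- Splitting of the Euler product according to residue classes. -/
lemma euler_eq_prod_residues {K : Type*} [NormedField K] [CompleteSpace K] {x : K} (hx : ‖x‖ < 1)
    {m : ℕ} (hm : 0 < m) :
    euler x = ∏ i ∈ Finset.range m, ∏' n : ℕ, (1 - x ^ (m * n + (i + 1))) := by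
  have h1 : Tendsto (fun N : ℕ => ∏ i ∈ Finset.range m, ∏ n ∈ Finset.range N,
      (1 - x ^ (m * n + (i + 1)))) atTop
      (𝓝 (∏ i ∈ Finset.range m, ∏' n : ℕ, (1 - x ^ (m * n + (i + 1))))) :=
    tendsto_finsetProd _ fun i _ =>
      (multipliable_one_sub_pow_linear hx hm (i + 1)).tendsto_prod_tprod_nat
  have h2 : Tendsto (fun N : ℕ => m * N) atTop atTop := tendsto_id.const_mul_atTop' hm
  refine tendsto_nhds_unique (((tendsto_eulerFin hx).comp h2).congr fun N => ?_) h1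
  rw [Function.comp, eulerFin, Finset.prod_comm]
  induction N with
  | zero => simp
  | succ N ih =>
    rw [Finset.prod_range_succ _ N, ← ih, Nat.mul_succ, Finset.prod_range_add]
    simp only [add_assoc]

lemma expProd_eq_prod_residues {u : ℝ} (hu : 0 < u) {m : ℕ} (hm : 0 < m) :
    expProd u u = ∏ i ∈ Finset.range m, expProd (m * u) ((i + 1) * u) := by
  rw [← euler_exp, euler_eq_prod_residues (norm_exp_neg_lt_one hu) hm]
  refine Finset.prod_congr rfl fun i _ => tprod_congr fun n => ?_
  rw [exp_neg_pow]; push_cast; ring_nf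

/-- The theta series `∑ (-1)^n q^{(10n+3)²/40}`, `q = e^{-u}`. -/
noncomputable def thetaA (u : ℝ) : ℝ := altTheta (5 * u / 2) (3 / 10)

/-- The theta series `∑ (-1)^n q^{(10n+1)²/40}`, `q = e^{-u}`. -/
noncomputable def thetaB (u : ℝ) : ℝ := altTheta (5 * u / 2) (1 / 10)

/-- The function `q^{1/24} ∏ (1 - q^n)`, `q = e^{-u}`. -/
noncomputable def etaExp (u : ℝ) : ℝ := Real.exp (-(u / 24)) * euler (Real.exp (-u))

lemma etaExp_pos {u : ℝ} (hu : 0 < u) : 0 < etaExp u :=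
  mul_pos (Real.exp_pos _) (euler_pos (Real.exp_nonneg _) (exp_neg_lt_one (by linarith)))

/-- Euler's pentagonal number theorem: the three factors of the triple product are the residue
classes modulo 3. -/
lemma etaExp_eq_altTheta {u : ℝ} (hu : 0 < u) : etaExp u = altTheta (3 * u / 2) (-1 / 6) := by
  rw [altTheta_eq_prod (by positivity), etaExp, euler_exp,
    expProd_eq_prod_residues hu (m := 3) (by norm_num)]
  simp only [Finset.prod_range_succ, Finset.prod_range_zero, one_mul]
  push_cast
  ring_nf

/-- The products of `thetaA` and `thetaB` contain the residues `±1` and `±2` modulo 5 respectively,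
and each contains the residue `0` once. -/
lemma thetaA_mul_thetaB {u : ℝ} (hu : 0 < u) : thetaA u * thetaB u = etaExp u * etaExp (5 * u) := by
  have e : Real.exp (-(5 * u / 2) * (3 / 10) ^ 2) * Real.exp (-(5 * u / 2) * (1 / 10) ^ 2) =
      Real.exp (-(u / 24)) * Real.exp (-(5 * u / 24)) := by
    rw [← Real.exp_add, ← Real.exp_add]; ring_nf
  rw [thetaA, thetaB, altTheta_eq_prod (by positivity), altTheta_eq_prod (by positivity), etaExp,
    etaExp, euler_exp, euler_exp, expProd_eq_prod_residues hu (m := 5) (by norm_num),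
    mul_mul_mul_comm, e]
  simp only [Finset.prod_range_succ, Finset.prod_range_zero, one_mul]
  push_cast
  ring_nf

/-- For `k = 0` the ratio of Euler products is `1`, and each term combines the theta terms with
indices `n` and `-(n+1)`. -/
lemma tailSeries_zero {u : ℝ} (hu : 0 < u) :
    tailSeries (Real.exp (-(u / 2))) 0 = Real.exp (u / 40) * thetaB u := by
  have h := (summable_thetaTerm (s := 5 * u / 2) (by positivity) (1 / 10)).hasSum.nat_add_neg_add_one
  rw [thetaB, altTheta, ← h.tsum_eq, ← tsum_mul_left]
  refine tsum_congr fun n => ?_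
  have : eulerRatio (Real.exp (-(u / 2))) 0 n = 1 := by
    have h1 : 0 < Real.exp (-(u / 2)) := Real.exp_pos _
    rw [eulerRatio, zero_add, div_self]
    exact (eulerFin_pos (by positivity) (pow_lt_one₀ h1.le (exp_neg_lt_one (by linarith))
      two_ne_zero) n).ne'
  rw [tailTerm, this, mul_one, thetaTerm, thetaTerm, zpow_neg, ← inv_zpow, inv_neg_one,
    zpow_add₀ (by norm_num), zpow_natCast, zpow_one, mul_sub, mul_one, mul_assoc (_ ^ n),
    ← pow_add, exp_neg_pow, exp_neg_pow, mul_add, mul_left_comm, ← Real.exp_add,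
    mul_left_comm _ ((-1) ^ n * -1), ← Real.exp_add]
  push_cast
  ring_nf

/-- The alternative form of the series is used because it involves `eulerRatio` with `k = 0`, which
is `1`. -/
lemma tailSeries_one {u : ℝ} (hu : 0 < u) :
    tailSeries (Real.exp (-(u / 2))) 1 = Real.exp (9 * u / 40) * thetaA u := by
  have h := (summable_thetaTerm (s := 5 * u / 2) (by positivity) (3 / 10)).hasSum.nat_add_neg_add_one
  rw [tailSeries_succ (Real.exp_pos _) (exp_neg_lt_one (by linarith)) 0, thetaA, altTheta,
    ← h.tsum_eq, ← tsum_mul_left]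
  refine tsum_congr fun n => ?_
  have : eulerRatio (Real.exp (-(u / 2))) 0 n = 1 := by
    have h1 : 0 < Real.exp (-(u / 2)) := Real.exp_pos _
    rw [eulerRatio, zero_add, div_self]
    exact (eulerFin_pos (by positivity) (pow_lt_one₀ h1.le (exp_neg_lt_one (by linarith))
      two_ne_zero) n).ne'
  rw [tailTerm', this, mul_one, thetaTerm, thetaTerm, zpow_neg, ← inv_zpow, inv_neg_one,
    zpow_add₀ (by norm_num), zpow_natCast, zpow_one, mul_sub, mul_one, mul_assoc (_ ^ n),
    ← pow_add, exp_neg_pow, exp_neg_pow, mul_add, mul_left_comm, ← Real.exp_add,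
    mul_left_comm _ ((-1) ^ n * -1), ← Real.exp_add]
  push_cast
  ring_nf

lemma isTail_exp {u : ℝ} (hu : 0 < u) :
    IsTail (Real.exp (-u)) (tailSeries (Real.exp (-(u / 2)))) := by
  have := isTail_tailSeries (Real.exp_pos (-(u / 2))) (exp_neg_lt_one (by linarith))
  rwa [exp_neg_pow, show ((2 : ℕ) : ℝ) * (u / 2) = u by push_cast; ring] at this

lemma thetaA_pos {u : ℝ} (hu : 0 < u) : 0 < thetaA u := by
  have := (isTail_exp hu).pos 1
  rw [tailSeries_one hu] at this
  exact pos_of_mul_pos_right this (Real.exp_nonneg _)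

lemma thetaB_pos {u : ℝ} (hu : 0 < u) : 0 < thetaB u := by
  have := (isTail_exp hu).pos 0
  rw [tailSeries_zero hu] at this
  exact pos_of_mul_pos_right this (Real.exp_nonneg _)

lemma R_exp_eq_tail {u : ℝ} (hu : 0 < u) : R (Real.exp (-u)) = Real.exp (-u) ^ (1 / 5 : ℝ) *
    (tailSeries (Real.exp (-(u / 2))) 1 / tailSeries (Real.exp (-(u / 2))) 0) := by
  have := R_sq_eq (Real.exp_pos (-(u / 2))) (exp_neg_lt_one (by linarith))
  rwa [exp_neg_pow, show ((2 : ℕ) : ℝ) * (u / 2) = u by push_cast; ring] at this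

lemma R_exp {u : ℝ} (hu : 0 < u) : R (Real.exp (-u)) = thetaA u / thetaB u := by
  have := thetaB_pos hu
  rw [R_exp_eq_tail hu, tailSeries_zero hu, tailSeries_one hu, ← Real.exp_mul,
    show 9 * u / 40 = u / 40 + u / 5 by ring, Real.exp_add,
    show -u * (1 / 5) = -(u / 5) by ring, Real.exp_neg]
  field_simp

lemma R_exp_le {u : ℝ} (hu : 0 < u) : R (Real.exp (-u)) ≤ Real.exp (-(u / 5)) := by
  have t := isTail_exp hu
  have h0 := t.pos 0
  have h1 := t.eq_add 0
  have h2 := t.pos 2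
  have : 0 < Real.exp (-u) := Real.exp_pos _
  rw [R_exp_eq_tail hu, ← Real.exp_mul, show -u * (1 / 5) = -(u / 5) by ring]
  refine mul_le_of_le_one_right (Real.exp_nonneg _) ((div_le_one h0).2 ?_)
  have : 0 < Real.exp (-u) ^ (0 + 1) * tailSeries (Real.exp (-(u / 2))) (0 + 2) := by positivity
  linarith

/-- For each `q < 1` the existence of a tail sequence places `R q` between all even and all odd
convergents. -/
lemma tendsto_R_one : Tendsto R (𝓝[<] 1) (𝓝 rMax) := by
  have key : ∀ q ∈ Set.Ioo (0 : ℝ) 1, ∃ y, IsTail q y ∧ R q = q ^ (1 / 5 : ℝ) * (y 1 / y 0) := by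
    rintro q ⟨h0, h1⟩
    have hu : 0 < -Real.log q := neg_pos.2 (Real.log_neg h0 h1)
    have e : Real.exp (- -Real.log q) = q := by rw [neg_neg, Real.exp_log h0]
    have a := isTail_exp hu
    have b := R_exp_eq_tail hu
    rw [e] at a b
    exact ⟨_, a, b⟩
  refine tendsto_of_between_convs (fun n q hq => ?_) (fun n q hq => ?_) <;>
  · obtain ⟨y, hy, e⟩ := key q hq
    rw [e]
    first
    | exact hy.convs_lt hq.1 n
    | exact hy.lt_convs hq.1 n

end AlternatingTheta

/-! ### Tools for double theta series, termwise differentiation, and the series for `η³`. -/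

section Lattice

lemma tsum_eq_sum_of_bijective {N : ℕ} {ι κ : Type*} {M : Type*}
    [NormedAddCommGroup M] [CompleteSpace M] {φ : Fin N × ι → κ}
    (hφ : Function.Bijective φ) {f : κ → M} (hf : Summable f) :
    ∑' x, f x = ∑ i, ∑' y, f (φ (i, y)) := by
  have h : Summable fun z => f (φ z) := (Equiv.ofBijective φ hφ).summable_iff.2 hf
  rw [← (Equiv.ofBijective φ hφ).tsum_eq f, ← tsum_fintype (L := .unconditional _)]
  exact h.tsum_prod

lemma neg_one_zpow_eq {a b : ℤ} (k : ℤ) (h : a = b + 2 * k) : (-1 : ℝ) ^ a = (-1) ^ b := by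
  rw [h, zpow_add₀ (by norm_num), zpow_mul]; norm_num

lemma neg_one_zpow_eq_neg {a b : ℤ} (k : ℤ) (h : a = b + 2 * k + 1) :
    (-1 : ℝ) ^ a = -(-1) ^ b := by
  rw [h, zpow_add₀ (by norm_num), zpow_add₀ (by norm_num), zpow_mul]; norm_num

/-- The general term of a theta series in two variables. -/
noncomputable def doubleTerm (u : ℝ) (w : ℝ) (e : ℤ) (x : ℝ) : ℝ := w * (-1) ^ e * Real.exp (-u * x)

lemma doubleTerm_congr {u w w' x x' : ℝ} {e e' : ℤ} (hw : w = w') (k : ℤ) (he : e = e' + 2 * k)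
    (hx : x = x') : doubleTerm u w e x = doubleTerm u w' e' x' := by
  rw [doubleTerm, doubleTerm, hw, hx, neg_one_zpow_eq k he]

lemma doubleTerm_congr_neg {u w w' x x' : ℝ} {e e' : ℤ} (hw : w = -w') (k : ℤ)
    (he : e = e' + 2 * k + 1) (hx : x = x') : doubleTerm u w e x = doubleTerm u w' e' x' := by
  rw [doubleTerm, doubleTerm, hw, hx, neg_one_zpow_eq_neg k he]
  ring

lemma sq_le_exp {s : ℝ} (hs : 0 < s) (x : ℝ) :
    x ^ 2 * Real.exp (-s * x ^ 2) ≤ 2 / s * Real.exp (-(s / 2) * x ^ 2) := by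
  have h := Real.add_one_le_exp (s / 2 * x ^ 2)
  have e : Real.exp (-s * x ^ 2) = Real.exp (-(s / 2) * x ^ 2) * Real.exp (-(s / 2 * x ^ 2)) := by
    rw [← Real.exp_add]; ring_nf
  have h1 : x ^ 2 * Real.exp (-(s / 2 * x ^ 2)) ≤ 2 / s := by
    rw [Real.exp_neg, ← div_eq_mul_inv, div_le_div_iff₀ (Real.exp_pos _) hs]
    linarith
  rw [e]
  calc _ = x ^ 2 * Real.exp (-(s / 2 * x ^ 2)) * Real.exp (-(s / 2) * x ^ 2) := by ring
    _ ≤ _ := by gcongr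

lemma summable_norm_sq_mul_thetaTerm {s : ℝ} (hs : 0 < s) (b : ℝ) :
    Summable fun n : ℤ => ‖((n : ℝ) + b) ^ 2 * thetaTerm s b n‖ := by
  refine Summable.of_nonneg_of_le (fun _ => norm_nonneg _) (fun n => ?_)
    ((summable_norm_thetaTerm (half_pos hs) b).mul_left (2 / s))
  rw [norm_mul, norm_thetaTerm, norm_thetaTerm, Real.norm_of_nonneg (by positivity)]
  exact sq_le_exp hs _

/-- Minus the derivative of the alternating theta series with respect to `s`. -/
noncomputable def altTheta₂ (s b : ℝ) : ℝ := ∑' n : ℤ, ((n : ℝ) + b) ^ 2 * thetaTerm s b n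

lemma hasDerivAt_altTheta {s : ℝ} (hs : 0 < s) (b : ℝ) :
    HasDerivAt (fun s => altTheta s b) (-altTheta₂ s b) s := by
  -- On `(s/2, ∞)` the differentiated terms are dominated by their values at `s/2`.
  have hmem : s ∈ Set.Ioi (s / 2) := half_lt_self hs
  rw [altTheta₂, ← tsum_neg]
  refine hasDerivAt_tsum_of_isPreconnected (g := fun n s => thetaTerm s b n)
    (g' := fun n s => -(((n : ℝ) + b) ^ 2 * thetaTerm s b n)) (t := Set.Ioi (s / 2)) (y₀ := s)
    (summable_norm_sq_mul_thetaTerm (half_pos hs) b) isOpen_Ioi isPreconnected_Ioi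
    (fun n y _ => ?_) (fun n y hy => ?_) hmem (summable_thetaTerm hs b) hmem
  · have h := (((hasDerivAt_id y).neg.mul_const (((n : ℝ) + b) ^ 2)).exp).const_mul ((-1 : ℝ) ^ n)
    refine h.congr_deriv ?_
    simp only [thetaTerm, Pi.neg_apply, id]
    ring
  · rw [norm_neg, norm_mul, norm_mul, norm_thetaTerm, norm_thetaTerm]
    gcongr
    exact le_of_lt hy

/-- Jacobi's identity sums `k f(k)`. Passing to the weight `2k + 1` adds `∑ f(k)`, which vanishes
since the triple product has a zero factor at `z = -p`. -/
lemma etaExp_cube {u : ℝ} (hu : 0 < u) :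
    ∑' j : ℤ, doubleTerm u (2 * j + 1) j ((2 * j + 1) ^ 2 / 8) = 2 * etaExp u ^ 3 := by
  have hp0 := Real.exp_ne_zero (-(u / 2))
  have hp1 := norm_exp_neg_lt_one (half_pos hu)
  have h3 := tsum_mul_eq_euler_cube hp0 hp1 (fun k => le_of_eq (by simp))
  have h1 := tsum_triple_product hp0 hp1 (neg_ne_zero.2 hp0)
  have s1 := summable_abs_pow_mul_gaussian hp0 hp1 (neg_ne_zero.2 hp0) 0
  have s3 := summable_abs_pow_mul_gaussian hp0 hp1 (neg_ne_zero.2 hp0) 1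
  have z : ∏' n : ℕ, (1 + (-Real.exp (-(u / 2)))⁻¹ * Real.exp (-(u / 2)) ^ (2 * n + 1)) = 0 :=
    tprod_of_exists_eq_zero ⟨0, by simp [inv_neg, hp0]⟩
  rw [z, mul_zero, mul_zero] at h1
  rw [exp_neg_pow, show ((2 : ℕ) : ℝ) * (u / 2) = u by push_cast; ring] at h3
  set f : ℤ → ℝ := fun k => Real.exp (-(u / 2)) ^ (k ^ 2) * (-Real.exp (-(u / 2))) ^ k with hf
  have s1' : Summable f := by
    refine Summable.of_norm (s1.congr fun k => ?_)
    rw [hf, norm_mul, norm_zpow, norm_zpow, pow_zero, one_mul]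
  have s3' : Summable fun k : ℤ => (k : ℝ) * f k := by
    refine Summable.of_norm (s3.congr fun k => ?_)
    rw [hf, norm_mul, norm_mul, norm_zpow, norm_zpow, pow_one]; simp
  have e : ∀ j : ℤ, doubleTerm u (2 * j + 1) j ((2 * j + 1) ^ 2 / 8) =
      Real.exp (-(u / 8)) * (2 * (j * f j) + f j) := by
    intro j
    have h := thetaTerm_eq (u / 2) (1 / 2) j
    rw [show -2 * (u / 2) * (1 / 2) = -(u / 2) by ring] at h
    have h2 : f j = Real.exp (u / 8) * thetaTerm (u / 2) (1 / 2) j := by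
      rw [h, ← mul_assoc, ← Real.exp_add, show u / 8 + -(u / 2) * (1 / 2) ^ 2 = 0 by ring,
        Real.exp_zero, one_mul]
    rw [h2, doubleTerm, thetaTerm, show 2 * ((j : ℝ) * (Real.exp (u / 8) * ((-1) ^ j *
      Real.exp (-(u / 2) * (j + 1 / 2) ^ 2)))) + Real.exp (u / 8) * ((-1) ^ j *
      Real.exp (-(u / 2) * (j + 1 / 2) ^ 2)) = Real.exp (u / 8) * ((2 * j + 1) * (-1) ^ j *
      Real.exp (-(u / 2) * (j + 1 / 2) ^ 2)) by ring, ← mul_assoc, ← Real.exp_add]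
    rw [show -(u / 8) + u / 8 = 0 by ring, Real.exp_zero, one_mul]
    ring_nf
  rw [tsum_congr e, tsum_mul_left, (s3'.mul_left 2).tsum_add s1', tsum_mul_left, h1, h3, etaExp,
    mul_pow, exp_neg_pow]
  push_cast
  ring_nf

end Lattice

/-! ### The Wronskian of `thetaA`, `thetaB` and the derivative of `R`. -/

section GaussianLattice

lemma hasSum_mul_prod {ι κ : Type*} {f : ι → ℝ} {g : κ → ℝ} (hf : Summable fun i => ‖f i‖)
    (hg : Summable fun i => ‖g i‖) :
    HasSum (fun z : ι × κ => f z.1 * g z.2) ((∑' i, f i) * ∑' k, g k) := by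
  rw [tsum_mul_tsum_of_summable_norm hf hg]
  exact (summable_mul_of_summable_norm hf hg).hasSum

lemma summable_norm_mul_thetaTerm {s : ℝ} (hs : 0 < s) (b : ℝ) :
    Summable fun n : ℤ => ‖((n : ℝ) + b) * thetaTerm s b n‖ := by
  refine Summable.of_nonneg_of_le (fun _ => norm_nonneg _) (fun n => ?_)
    ((summable_norm_thetaTerm hs b).add (summable_norm_sq_mul_thetaTerm hs b))
  rw [norm_mul, norm_mul, ← one_add_mul]
  gcongr
  rw [norm_pow]
  nlinarith [sq_nonneg (‖(n : ℝ) + b‖ - 1), norm_nonneg ((n : ℝ) + b)]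

/-- The Wronskian-type double series attached to `thetaA` and `thetaB`. -/
noncomputable def wronskianTerm (u : ℝ) (z : ℤ × ℤ) : ℝ :=
  doubleTerm u ((10 * z.1 + 3) ^ 2 - (10 * z.2 + 1) ^ 2) (z.1 + z.2)
    (((10 * z.1 + 3) ^ 2 + (10 * z.2 + 1) ^ 2) / 40)

lemma hasSum_wronskianTerm {u : ℝ} (hu : 0 < u) : HasSum (wronskianTerm u)
    (100 * (altTheta₂ (5 * u / 2) (3 / 10) * thetaB u - thetaA u * altTheta₂ (5 * u / 2) (1 / 10))) := by
  have hs : 0 < 5 * u / 2 := by positivity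
  have h1 := hasSum_mul_prod (summable_norm_sq_mul_thetaTerm hs (3 / 10))
    (summable_norm_thetaTerm hs (1 / 10))
  have h2 := hasSum_mul_prod (summable_norm_thetaTerm hs (3 / 10))
    (summable_norm_sq_mul_thetaTerm hs (1 / 10))
  refine hasSum_congr_both ((h1.sub h2).mul_left 100) (fun z => ?_) rfl
  rw [show thetaTerm (5 * u / 2) (3 / 10) z.1 * (((z.2 : ℝ) + 1 / 10) ^ 2 *
      thetaTerm (5 * u / 2) (1 / 10) z.2) = ((z.2 : ℝ) + 1 / 10) ^ 2 *
      (thetaTerm (5 * u / 2) (3 / 10) z.1 * thetaTerm (5 * u / 2) (1 / 10) z.2) by ring,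
    mul_assoc (_ ^ 2), ← sub_mul]
  have e : thetaTerm (5 * u / 2) (3 / 10) z.1 * thetaTerm (5 * u / 2) (1 / 10) z.2 =
      doubleTerm u 1 (z.1 + z.2) (((10 * z.1 + 3) ^ 2 + (10 * z.2 + 1) ^ 2) / 40) := by
    rw [thetaTerm, thetaTerm, doubleTerm, mul_mul_mul_comm, ← zpow_add₀ (by norm_num),
      ← Real.exp_add]
    ring_nf
  rw [e, wronskianTerm, doubleTerm, doubleTerm]
  ring

/-- The double series for `8 (∑ (-1)^j (2j+1) q^{(2j+1)²/8})²` with a vanishing part added. -/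
noncomputable def sixthTerm (u : ℝ) (z : ℤ × ℤ) : ℝ :=
  doubleTerm u (3 * ((2 * z.1 + 1) ^ 2 - (2 * z.2 + 1) ^ 2) + 8 * ((2 * z.1 + 1) * (2 * z.2 + 1)))
    (z.1 + z.2) (((2 * z.1 + 1) ^ 2 + (2 * z.2 + 1) ^ 2) / 8)

/-- The part with weight `3 (X² - Y²)`, `X` and `Y` odd, is antisymmetric under exchange and sums to
zero; the part `8XY` gives `8 (2η³)²`. -/
lemma hasSum_sixthTerm {u : ℝ} (hu : 0 < u) : HasSum (sixthTerm u) (32 * etaExp u ^ 6) := by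
  have hs : 0 < u / 2 := by positivity
  have h1 := hasSum_mul_prod (summable_norm_sq_mul_thetaTerm hs (1 / 2))
    (summable_norm_thetaTerm hs (1 / 2))
  have h2 := hasSum_mul_prod (summable_norm_thetaTerm hs (1 / 2))
    (summable_norm_sq_mul_thetaTerm hs (1 / 2))
  have h3 := hasSum_mul_prod (summable_norm_mul_thetaTerm hs (1 / 2))
    (summable_norm_mul_thetaTerm hs (1 / 2))
  have e0 : ∀ n : ℤ, doubleTerm u (2 * n + 1) n ((2 * n + 1) ^ 2 / 8) =
      2 * (((n : ℝ) + 1 / 2) * thetaTerm (u / 2) (1 / 2) n) := by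
    intro n
    rw [doubleTerm, thetaTerm]
    ring_nf
  have h4 := etaExp_cube hu
  rw [tsum_congr e0, tsum_mul_left] at h4
  have h5 := mul_left_cancel₀ two_ne_zero h4
  refine hasSum_congr_both (((h1.sub h2).mul_left 12).add (h3.mul_left 32)) (fun z => ?_)
    (by rw [h5]; ring)
  have e : thetaTerm (u / 2) (1 / 2) z.1 * thetaTerm (u / 2) (1 / 2) z.2 =
      doubleTerm u 1 (z.1 + z.2) (((2 * z.1 + 1) ^ 2 + (2 * z.2 + 1) ^ 2) / 8) := by
    rw [thetaTerm, thetaTerm, doubleTerm, mul_mul_mul_comm, ← zpow_add₀ (by norm_num),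
      ← Real.exp_add]
    ring_nf
  rw [show ∀ a b c d x y : ℝ, 12 * (a * x * y - x * (b * y)) + 32 * ((c * x) * (d * y)) =
      (12 * (a - b) + 32 * (c * d)) * (x * y) by intros; ring, e, sixthTerm, doubleTerm, doubleTerm]
  ring

/-- The five cosets of the sublattice `(2 + i) ℤ[i]`. -/
def gaussianCoset (x : Fin 5 × (ℤ × ℤ)) : ℤ × ℤ :=
  (2 * x.2.1 - x.2.2 + x.1.val, x.2.1 + 2 * x.2.2)

lemma gaussianCoset_bijective : Function.Bijective gaussianCoset := by
  constructor
  · rintro ⟨⟨i, hi⟩, m, n⟩ ⟨⟨i', hi'⟩, m', n'⟩ h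
    simp only [gaussianCoset, Prod.mk.injEq] at h
    simp only [Prod.mk.injEq, Fin.mk.injEq]
    omega
  · rintro ⟨j, k⟩
    refine ⟨(⟨((j - 2 * k) % 5).toNat, by omega⟩,
      ((2 * (j - (j - 2 * k) % 5) + k) / 5, (2 * k - (j - (j - 2 * k) % 5)) / 5)), ?_⟩
    simp only [gaussianCoset, Prod.mk.injEq]
    omega

lemma tsum_comp_of_bijective {f g : ℤ × ℤ → ℝ} {σ : ℤ × ℤ → ℤ × ℤ} (hσ : Function.Bijective σ)
    (h : ∀ z, g z = f (σ z)) : ∑' z, g z = ∑' z, f z := by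
  rw [tsum_congr h]
  exact (Equiv.ofBijective σ hσ).tsum_eq f

/-- With `z = X + iY`, the weight `3 (X² - Y²) + 8XY` is the real part of `((2 - i) z)²`, and `|(2 -
i) z|² = 5 |z|²`. On the coset `c` one has `(2 - i) z ≡ (3 + 4c) + (1 - 2c) i` modulo `10`. For `c =
0, 1, 2, 4` this is a unit times `3 + i`, which gives the Wronskian series; for `c = 3` both
coordinates are `5` modulo `10`, and exchanging them negates the sum. -/
lemma tsum_sixthTerm_eq {u : ℝ} (hu : 0 < u) :
    ∑' z, sixthTerm u z = 4 * ∑' z, wronskianTerm u z := by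
  rw [tsum_eq_sum_of_bijective gaussianCoset_bijective (hasSum_sixthTerm hu).summable,
    Fin.sum_univ_five]
  have h0 : ∑' z, sixthTerm u (gaussianCoset (0, z)) = ∑' z, wronskianTerm u z := by
    refine tsum_congr fun z => ?_
    refine doubleTerm_congr ?_ z.1 ?_ ?_ <;> simp [gaussianCoset] <;> ring
  have h1 : ∑' z, sixthTerm u (gaussianCoset (1, z)) = ∑' z, wronskianTerm u z := by
    refine tsum_comp_of_bijective (σ := fun z => (-z.1 - 1, -z.2)) ⟨fun a b h => ?_, fun b =>
      ⟨(-b.1 - 1, -b.2), by ext <;> simp⟩⟩ fun z => ?_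
    · simp only [Prod.mk.injEq] at h; ext <;> omega
    refine doubleTerm_congr ?_ (2 * z.1 + z.2 + 1) ?_ ?_ <;> simp [gaussianCoset] <;> ring
  have h2 : ∑' z, sixthTerm u (gaussianCoset (2, z)) = ∑' z, wronskianTerm u z := by
    refine tsum_comp_of_bijective (σ := fun z => (-z.2, z.1 + 1)) ⟨fun a b h => ?_, fun b =>
      ⟨(b.2 - 1, -b.1), by ext <;> simp⟩⟩ fun z => ?_
    · simp only [Prod.mk.injEq] at h; ext <;> omega
    refine doubleTerm_congr_neg ?_ (z.1 + z.2) ?_ ?_ <;> simp [gaussianCoset] <;> ring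
  have h3 : ∑' z, sixthTerm u (gaussianCoset (3, z)) = 0 := by
    have : ∑' z, sixthTerm u (gaussianCoset (3, z)) =
        ∑' z, -sixthTerm u (gaussianCoset (3, z)) := by
      refine tsum_comp_of_bijective (f := fun z => -sixthTerm u (gaussianCoset (3, z)))
        (σ := fun z => (z.2 - 2, z.1 + 2)) ⟨fun a b h => ?_, fun b =>
        ⟨(b.2 - 2, b.1 + 2), by ext <;> simp⟩⟩ fun z => ?_
      · simp only [Prod.mk.injEq] at h; ext <;> omega
      rw [sixthTerm, sixthTerm, doubleTerm, doubleTerm, ← neg_mul, ← neg_mul]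
      refine doubleTerm_congr ?_ (z.1 - z.2 + 2) ?_ ?_ <;> simp [gaussianCoset] <;> ring
    rw [tsum_neg] at this
    linarith
  have h4 : ∑' z, sixthTerm u (gaussianCoset (4, z)) = ∑' z, wronskianTerm u z := by
    refine tsum_comp_of_bijective (σ := fun z => (z.2 - 1, -z.1 - 2)) ⟨fun a b h => ?_, fun b =>
      ⟨(-b.2 - 2, b.1 + 1), by ext <;> simp⟩⟩ fun z => ?_
    · simp only [Prod.mk.injEq] at h; ext <;> omega
    refine doubleTerm_congr_neg ?_ (2 * z.1 + 3) ?_ ?_ <;> simp [gaussianCoset] <;> ring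
  rw [h0, h1, h2, h3, h4]
  ring

lemma wronskian_eq {u : ℝ} (hu : 0 < u) :
    altTheta₂ (5 * u / 2) (3 / 10) * thetaB u - thetaA u * altTheta₂ (5 * u / 2) (1 / 10) =
      2 / 25 * etaExp u ^ 6 := by
  have h := tsum_sixthTerm_eq hu
  rw [(hasSum_sixthTerm hu).tsum_eq, (hasSum_wronskianTerm hu).tsum_eq] at h
  linarith

/-- The derivative of the Rogers–Ramanujan continued fraction in terms of the eta function. -/
lemma hasDerivAt_R_exp {u : ℝ} (hu : 0 < u) : HasDerivAt (fun u => R (Real.exp (-u)))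
    (-(R (Real.exp (-u)) * (etaExp u ^ 5 / etaExp (5 * u)) / 5)) u := by
  have hB := thetaB_pos hu
  have hA := thetaA_pos hu
  have hs : 0 < 5 * u / 2 := by positivity
  have hd : HasDerivAt (fun u : ℝ => 5 * u / 2) (5 / 2) u := by
    simpa using ((hasDerivAt_id u).const_mul 5).div_const 2
  have dA : HasDerivAt thetaA (-altTheta₂ (5 * u / 2) (3 / 10) * (5 / 2)) u :=
    HasDerivAt.comp (h₂ := fun s => altTheta s (3 / 10)) u (hasDerivAt_altTheta hs _) hd
  have dB : HasDerivAt thetaB (-altTheta₂ (5 * u / 2) (1 / 10) * (5 / 2)) u :=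
    HasDerivAt.comp (h₂ := fun s => altTheta s (1 / 10)) u (hasDerivAt_altTheta hs _) hd
  have h := (dA.div dB hB.ne').congr_of_eventuallyEq
    (f₁ := fun u => R (Real.exp (-u))) (by
      filter_upwards [lt_mem_nhds hu] with v hv
      exact R_exp hv)
  refine h.congr_deriv ?_
  have e := etaExp_pos hu
  have e5 := etaExp_pos (u := 5 * u) (by positivity)
  have w := wronskian_eq hu
  have p := thetaA_mul_thetaB hu
  rw [R_exp hu, show thetaA u / thetaB u * (etaExp u ^ 5 / etaExp (5 * u)) =
    etaExp u ^ 6 / thetaB u ^ 2 by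
      field_simp
      linear_combination p]
  field_simp
  linear_combination -25 * w

end GaussianLattice

/-! ### Products of theta series via the hexagonal lattice. -/

section EisensteinLattice

/-- The two cosets of the sublattice of index two `{(n, m) | n ≡ m mod 2}`. -/
def parityCoset (x : Fin 2 × (ℤ × ℤ)) : ℤ × ℤ :=
  (x.2.1 + x.2.2 + x.1.val, x.2.1 - x.2.2)

lemma parityCoset_bijective : Function.Bijective parityCoset := by
  constructor
  · rintro ⟨⟨i, hi⟩, m, n⟩ ⟨⟨i', hi'⟩, m', n'⟩ h
    simp only [parityCoset, Prod.mk.injEq] at h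
    simp only [Prod.mk.injEq, Fin.mk.injEq]
    omega
  · rintro ⟨j, k⟩
    refine ⟨(⟨((j + k) % 2).toNat, by omega⟩, ((j + k) / 2, (j + k) / 2 - k)), ?_⟩
    simp only [parityCoset, Prod.mk.injEq]
    omega

/-- The sum of `q^{(15 (n + b)² + 5 (m + c)²)/2}` over one parity class of `n + m`. -/
noncomputable def parityTerm (u b c i : ℝ) (z : ℤ × ℤ) : ℝ :=
  Real.exp (-u * (15 / 2 * (z.1 + z.2 + i + b) ^ 2 + 5 / 2 * (z.1 - z.2 + c) ^ 2))

/-- The sign depends only on the parity of `n + m`. On a parity class the form `3N² + M²` becomes `4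
(a² + ab + b²)` up to a shift, whose hexagonal symmetries are exploited next. -/
lemma altTheta_mul_altTheta {u : ℝ} (hu : 0 < u) (b c : ℝ) :
    altTheta (15 * u / 2) b * altTheta (5 * u / 2) c =
      ∑' z, parityTerm u b c 0 z - ∑' z, parityTerm u b c 1 z := by
  have h := hasSum_mul_prod (summable_norm_thetaTerm (s := 15 * u / 2) (by positivity) b)
    (summable_norm_thetaTerm (s := 5 * u / 2) (by positivity) c)
  rw [altTheta, altTheta, ← h.tsum_eq, tsum_eq_sum_of_bijective parityCoset_bijective h.summable,
    Fin.sum_univ_two, sub_eq_add_neg, ← tsum_neg]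
  congr 1 <;> refine tsum_congr fun z => ?_
  · rw [thetaTerm, thetaTerm, mul_mul_mul_comm, ← zpow_add₀ (by norm_num), ← Real.exp_add,
      parityTerm, neg_one_zpow_eq (b := 0) z.1 (by simp [parityCoset]; ring)]
    simp [parityCoset]
    ring
  · rw [thetaTerm, thetaTerm, mul_mul_mul_comm, ← zpow_add₀ (by norm_num), ← Real.exp_add,
      parityTerm, neg_one_zpow_eq_neg (b := 0) z.1 (by simp [parityCoset]; ring)]
    simp [parityCoset]
    ring

lemma tsum_parityTerm_congr {u b c i b' c' i' : ℝ} {σ : ℤ × ℤ → ℤ × ℤ}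
    (τ : ℤ × ℤ → ℤ × ℤ) (h₁ : Function.LeftInverse τ σ) (h₂ : Function.RightInverse τ σ)
    (h : ∀ z : ℤ × ℤ, 15 / 2 * ((z.1 : ℝ) + z.2 + i + b) ^ 2 + 5 / 2 * (z.1 - z.2 + c) ^ 2 =
      15 / 2 * (((σ z).1 : ℝ) + (σ z).2 + i' + b') ^ 2 + 5 / 2 * ((σ z).1 - (σ z).2 + c') ^ 2) :
    ∑' z, parityTerm u b c i z = ∑' z, parityTerm u b' c' i' z := by
  refine tsum_comp_of_bijective (σ := σ) ⟨h₁.injective, h₂.surjective⟩ fun z => ?_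
  rw [parityTerm, parityTerm, h]

/-- Rotations of the hexagonal lattice match two half-sums with those on the right; the other two
cancel. -/
lemma dissection_zero_mul {u : ℝ} (hu : 0 < u) :
    (altTheta (15 * u / 2) (-1 / 30) + altTheta (15 * u / 2) (11 / 30)) * thetaA u =
      altTheta (15 * u / 2) (-1 / 6) * thetaB u := by
  have h1 : ∑' z, parityTerm u (-1 / 30) (3 / 10) 0 z = ∑' z, parityTerm u (-1 / 6) (1 / 10) 0 z :=
    tsum_parityTerm_congr (σ := fun z => (z.1 + z.2, -z.1)) (fun z => (-z.2, z.1 + z.2))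
      (fun z => by ext <;> dsimp only <;> omega) (fun z => by ext <;> dsimp only <;> omega) fun z => by push_cast; ring
  have h2 : ∑' z, parityTerm u (-1 / 30) (3 / 10) 1 z = ∑' z, parityTerm u (11 / 30) (3 / 10) 0 z :=
    tsum_parityTerm_congr (σ := fun z => (z.2, -z.1 - z.2 - 1)) (fun z => (-z.1 - z.2 - 1, z.1))
      (fun z => by ext <;> dsimp only <;> omega) (fun z => by ext <;> dsimp only <;> omega) fun z => by push_cast; ring
  have h3 : ∑' z, parityTerm u (11 / 30) (3 / 10) 1 z = ∑' z, parityTerm u (-1 / 6) (1 / 10) 1 z :=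
    tsum_parityTerm_congr (σ := fun z => (-z.2 - 1, z.1 + z.2 + 1)) (fun z => (z.1 + z.2, -z.1 - 1))
      (fun z => by ext <;> dsimp only <;> omega) (fun z => by ext <;> dsimp only <;> omega) fun z => by push_cast; ring
  rw [thetaA, thetaB, add_mul, altTheta_mul_altTheta hu, altTheta_mul_altTheta hu,
    altTheta_mul_altTheta hu, h1, h2, h3]
  ring

/-- The same matching and cancellation, with reflections of the hexagonal lattice besides a
rotation. -/
lemma dissection_two_mul {u : ℝ} (hu : 0 < u) :
    (altTheta (15 * u / 2) (17 / 30) - altTheta (15 * u / 2) (23 / 30)) * thetaB u =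
      altTheta (15 * u / 2) (-1 / 6) * thetaA u := by
  have h1 : ∑' z, parityTerm u (17 / 30) (1 / 10) 0 z = ∑' z, parityTerm u (23 / 30) (1 / 10) 0 z :=
    tsum_parityTerm_congr (σ := fun z => (-z.1 - z.2 - 1, z.1)) (fun z => (z.2, -z.1 - z.2 - 1))
      (fun z => by ext <;> dsimp only <;> omega) (fun z => by ext <;> dsimp only <;> omega) fun z => by push_cast; ring
  have h2 : ∑' z, parityTerm u (17 / 30) (1 / 10) 1 z = ∑' z, parityTerm u (-1 / 6) (3 / 10) 1 z :=
    tsum_parityTerm_congr (σ := fun z => (z.1 + z.2 + 1, -z.2 - 1)) (fun z => (z.1 + z.2, -z.2 - 1))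
      (fun z => by ext <;> dsimp only <;> omega) (fun z => by ext <;> dsimp only <;> omega) fun z => by push_cast; ring
  have h3 : ∑' z, parityTerm u (23 / 30) (1 / 10) 1 z = ∑' z, parityTerm u (-1 / 6) (3 / 10) 0 z :=
    tsum_parityTerm_congr (σ := fun z => (-z.1 - 1, z.1 + z.2 + 2))
      (fun z => (-z.1 - 1, z.1 + z.2 - 1))
      (fun z => by ext <;> dsimp only <;> omega) (fun z => by ext <;> dsimp only <;> omega) fun z => by push_cast; ring
  rw [thetaA, thetaB, sub_mul, altTheta_mul_altTheta hu, altTheta_mul_altTheta hu,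
    altTheta_mul_altTheta hu, h1, h2, h3]
  ring

end EisensteinLattice

/-! ### Five-dissection of the Euler product and the relation for `R^5`. -/

section Dissection

/-- The residue classes modulo five. -/
def residueFive (x : Fin 5 × ℤ) : ℤ := 5 * x.2 + x.1.val

lemma residueFive_bijective : Function.Bijective residueFive := by
  constructor
  · rintro ⟨⟨i, hi⟩, m⟩ ⟨⟨i', hi'⟩, m'⟩ h
    simp only [residueFive] at h
    simp only [Prod.mk.injEq, Fin.mk.injEq]
    omega
  · intro j
    refine ⟨(⟨(j % 5).toNat, by omega⟩, j / 5), ?_⟩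
    simp only [residueFive]
    omega

lemma altTheta_neg (s b : ℝ) : altTheta s (-b) = altTheta s b := by
  rw [altTheta, altTheta, ← (Equiv.neg ℤ).tsum_eq]
  refine tsum_congr fun n => ?_
  simp only [thetaTerm, Equiv.neg_apply, zpow_neg, ← inv_zpow, inv_neg_one]
  push_cast
  ring_nf

lemma euler_sq_eq_tsum {K : Type*} [NormedField K] [CompleteSpace K] {w : K} (hw0 : w ≠ 0)
    (hw : ‖w‖ < 1) : euler (w ^ 2) = ∑' k : ℤ, (w ^ 3) ^ (k ^ 2) * (-w⁻¹) ^ k := by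
  have h3 : ‖w ^ 3‖ < 1 := by
    rw [norm_pow]; exact pow_lt_one₀ (norm_nonneg _) hw (by norm_num)
  rw [tsum_triple_product (pow_ne_zero 3 hw0) h3 (neg_ne_zero.2 (inv_ne_zero hw0)),
    euler_eq_prod_residues (norm_sq_lt_one hw) (m := 3) (by norm_num)]
  simp only [Finset.prod_range_succ, Finset.prod_range_zero, one_mul]
  rw [mul_comm]
  congr 1
  · refine tprod_congr fun n => ?_
    ring
  · congr 1 <;> refine tprod_congr fun n => ?_
    · rw [show w ^ 3 = w * w ^ 2 by ring, mul_pow, ← pow_mul, pow_succ w (2 * n)]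
      field_simp
      ring
    · rw [inv_neg, inv_inv]
      ring

/-- The terms of the pentagonal number series in the residue classes modulo five. -/
lemma pentagonal_term_residue {X : ℂ} (hX : X ^ 5 = 1) (u : ℝ) (n i m : ℤ) (e : ℕ)
    (h : 9 * i ^ 2 - 3 * i = e + 5 * m) :
    ((X ^ 3 * (Real.exp (-(u / 10)) : ℂ)) ^ 3) ^ ((5 * n + i) ^ 2) *
      (-(X ^ 3 * (Real.exp (-(u / 10)) : ℂ))⁻¹) ^ (5 * n + i) =
    ((Real.exp (u / 120) : ℝ) : ℂ) * ((-1) ^ i * X ^ e *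
      (thetaTerm (15 * u / 2) ((6 * i - 1) / 30) n : ℝ)) := by
  have hX0 : X ≠ 0 := fun h => by simp [h] at hX
  have hr0 : (Real.exp (-(u / 10)) : ℂ) ≠ 0 := by simp
  have hw : X ^ 3 * (Real.exp (-(u / 10)) : ℂ) ≠ 0 := mul_ne_zero (pow_ne_zero _ hX0) hr0
  rw [neg_eq_neg_one_mul (_ ⁻¹), mul_zpow, ← zpow_natCast _ 3, ← zpow_mul, ← zpow_neg_one (_ * _),
    ← zpow_mul, mul_left_comm, ← zpow_add₀ hw, mul_zpow]
  have e1 : (X ^ 3) ^ (((3 : ℕ) : ℤ) * (5 * n + i) ^ 2 + -1 * (5 * n + i)) = X ^ e := by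
    rw [← zpow_natCast X 3, ← zpow_mul, show ((3 : ℕ) : ℤ) *
      (((3 : ℕ) : ℤ) * (5 * n + i) ^ 2 + -1 * (5 * n + i)) =
      e + ((5 : ℕ) : ℤ) * (45 * n ^ 2 + 18 * n * i - 3 * n + m) by push_cast; linear_combination h,
      zpow_add₀ hX0, zpow_mul, zpow_natCast, zpow_natCast, hX, one_zpow, mul_one]
  have e2 : Real.exp (-(u / 10)) ^ (((3 : ℕ) : ℤ) * (5 * n + i) ^ 2 + -1 * (5 * n + i)) =
      Real.exp (u / 120) * Real.exp (-(15 * u / 2) * (n + (6 * i - 1) / 30) ^ 2) := by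
    rw [← Real.rpow_intCast, ← Real.exp_mul, ← Real.exp_add]
    push_cast
    ring_nf
  have e3 : (-1 : ℂ) ^ (5 * n + i) = (-1) ^ i * (-1) ^ n := by
    rw [add_comm, zpow_add₀ (by norm_num), zpow_mul]; norm_num
  rw [e1, e3, ← Complex.ofReal_zpow, e2, thetaTerm]
  push_cast
  ring

/-- The five-dissection of the Euler product. -/
lemma euler_dissection {X : ℂ} (hX : X ^ 5 = 1) {u : ℝ} (hu : 0 < u) :
    euler (X * (Real.exp (-(u / 5)) : ℝ)) = ((Real.exp (u / 120) : ℝ) : ℂ) *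
      ((altTheta (15 * u / 2) (-1 / 30) + altTheta (15 * u / 2) (11 / 30) : ℝ)
        - X * (altTheta (15 * u / 2) (-1 / 6) : ℝ)
        - X ^ 2 * (altTheta (15 * u / 2) (17 / 30) - altTheta (15 * u / 2) (23 / 30) : ℝ)) := by
  have hX0 : X ≠ 0 := fun h => by simp [h] at hX
  have hXn : ‖X‖ = 1 := Complex.norm_eq_one_of_pow_eq_one hX (by norm_num)
  -- Since `X^6 = X`, this is a square root of `X e^{-u/5}`, as the pentagonal series in `w`
  -- requires.
  set w : ℂ := X ^ 3 * (Real.exp (-(u / 10)) : ℂ) with hwdef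
  have hw0 : w ≠ 0 := mul_ne_zero (pow_ne_zero _ hX0) (by simp)
  have hw1 : ‖w‖ < 1 := by
    rw [hwdef, norm_mul, norm_pow, hXn, one_pow, one_mul, Complex.norm_real]
    exact norm_exp_neg_lt_one (by positivity)
  have hw2 : X * (Real.exp (-(u / 5)) : ℝ) = w ^ 2 := by
    rw [hwdef, mul_pow, ← pow_mul, show X ^ (3 * 2) = X ^ 5 * X by ring, hX, one_mul,
      ← Complex.ofReal_pow, exp_neg_pow]
    push_cast
    ring_nf
  have hs : Summable fun k : ℤ => (w ^ 3) ^ (k ^ 2) * (-w⁻¹) ^ k := by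
    refine Summable.of_norm ((summable_abs_pow_mul_gaussian (pow_ne_zero 3 hw0) ?_
      (neg_ne_zero.2 (inv_ne_zero hw0)) 0).congr fun k => ?_)
    · rw [norm_pow]; exact pow_lt_one₀ (norm_nonneg _) hw1 (by norm_num)
    · rw [norm_mul, norm_zpow, norm_zpow, pow_zero, one_mul]
  have hpart : ∀ (i m : ℤ) (e : ℕ), 9 * i ^ 2 - 3 * i = e + 5 * m →
      ∑' n : ℤ, (w ^ 3) ^ ((5 * n + i) ^ 2) * (-w⁻¹) ^ (5 * n + i) =
      ((Real.exp (u / 120) : ℝ) : ℂ) * ((-1) ^ i * X ^ e *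
        (altTheta (15 * u / 2) ((6 * i - 1) / 30) : ℝ)) := by
    intro i m e h
    rw [tsum_congr fun n => pentagonal_term_residue hX u n i m e h, tsum_mul_left, tsum_mul_left,
      altTheta, Complex.ofReal_tsum]
  rw [hw2, euler_sq_eq_tsum hw0 hw1, tsum_eq_sum_of_bijective residueFive_bijective hs,
    Fin.sum_univ_five]
  -- The exponents `9i² - 3i` take only the residues `0, 1, 0, 2, 2` modulo 5, so just three powers
  -- of `X` occur.
  have h0 := hpart 0 0 0 (by norm_num)
  have h1 := hpart 1 1 1 (by norm_num)
  have h2 := hpart 2 6 0 (by norm_num)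
  have h3 := hpart 3 14 2 (by norm_num)
  have h4 := hpart 4 26 2 (by norm_num)
  have e1 : altTheta (15 * u / 2) (5 / 30) = altTheta (15 * u / 2) (-1 / 6) := by
    rw [show (-1 / 6 : ℝ) = -(5 / 30) by norm_num, altTheta_neg]
  rw [show (6 * ((0 : ℤ) : ℝ) - 1) / 30 = -1 / 30 by norm_num] at h0
  rw [show (6 * ((1 : ℤ) : ℝ) - 1) / 30 = 5 / 30 by norm_num, e1] at h1
  rw [show (6 * ((2 : ℤ) : ℝ) - 1) / 30 = 11 / 30 by norm_num] at h2
  rw [show (6 * ((3 : ℤ) : ℝ) - 1) / 30 = 17 / 30 by norm_num] at h3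
  rw [show (6 * ((4 : ℤ) : ℝ) - 1) / 30 = 23 / 30 by norm_num] at h4
  have hc : ∀ i : Fin 5, ∑' n : ℤ, (w ^ 3) ^ (residueFive (i, n) ^ 2) *
      (-w⁻¹) ^ residueFive (i, n) =
      ∑' n : ℤ, (w ^ 3) ^ ((5 * n + (i.val : ℤ)) ^ 2) * (-w⁻¹) ^ (5 * n + (i.val : ℤ)) :=
    fun i => rfl
  simp only [hc]
  rw [show (((0 : Fin 5).val : ℕ) : ℤ) = 0 from rfl, show (((1 : Fin 5).val : ℕ) : ℤ) = 1 from rfl,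
    show (((2 : Fin 5).val : ℕ) : ℤ) = 2 from rfl, show (((3 : Fin 5).val : ℕ) : ℤ) = 3 from rfl,
    show (((4 : Fin 5).val : ℕ) : ℤ) = 4 from rfl, h0, h1, h2, h3, h4]
  have z2 : (-1 : ℂ) ^ (2 : ℤ) = 1 := by norm_num
  have z3 : (-1 : ℂ) ^ (3 : ℤ) = -1 := by
    rw [show (3 : ℤ) = ((3 : ℕ) : ℤ) from rfl, zpow_natCast]; norm_num
  have z4 : (-1 : ℂ) ^ (4 : ℤ) = 1 := by
    rw [show (4 : ℤ) = ((4 : ℕ) : ℤ) from rfl, zpow_natCast]; norm_num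
  rw [zpow_zero, zpow_one, z2, z3, z4]
  push_cast
  ring

lemma prod_one_sub_mul_of_geom_sum {ξ : ℂ} (h : 1 + ξ + ξ ^ 2 + ξ ^ 3 + ξ ^ 4 = 0) (y : ℂ) :
    ∏ j ∈ Finset.range 5, (1 - ξ ^ j * y) = 1 - y ^ 5 := by
  simp only [Finset.prod_range_succ, Finset.prod_range_zero]
  linear_combination (-ξ ^ 6 * y ^ 5 + ξ ^ 6 * y ^ 4 + ξ ^ 5 * y ^ 5 - ξ ^ 5 * y ^ 3 - ξ ^ 3 * y ^ 3
    + ξ ^ 3 * y ^ 2 - ξ * y ^ 5 + ξ * y ^ 2 + y ^ 5 - y) * h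

/-- With the golden ratio `g`, the factor is `v (1 - X g u)(1 - X (1 - g) u)`, because `g (1 - g) =
-1`. The `11` is `g^5 + (1 - g)^5`. -/
lemma prod_quadratic_of_geom_sum {ξ : ℂ} (h : 1 + ξ + ξ ^ 2 + ξ ^ 3 + ξ ^ 4 = 0) {u v : ℂ}
    (huv : u * v = 1) :
    ∏ j ∈ Finset.range 5, (v - ξ ^ j - (ξ ^ j) ^ 2 * u) = v ^ 5 - 11 - u ^ 5 := by
  obtain ⟨g, hg⟩ : ∃ g : ℂ, g ^ 2 = g + 1 := by
    refine ⟨(Real.goldenRatio : ℝ), ?_⟩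
    exact_mod_cast Real.goldenRatio_sq
  have hf : ∀ j ∈ Finset.range 5, v - ξ ^ j - (ξ ^ j) ^ 2 * u =
      v * ((1 - ξ ^ j * (g * u)) * (1 - ξ ^ j * ((1 - g) * u))) := fun j _ => by
    linear_combination (ξ ^ j + (ξ ^ j) ^ 2 * u * (g ^ 2 - g)) * huv + (ξ ^ j) ^ 2 * u * hg
  have h5 : g ^ 5 = 5 * g + 3 := by linear_combination (g ^ 3 + g ^ 2 + 2 * g + 3) * hg
  have h5' : (1 - g) ^ 5 = 8 - 5 * g := by
    linear_combination (-g ^ 3 + 4 * g ^ 2 - 7 * g + 7) * hg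
  rw [Finset.prod_congr rfl hf, Finset.prod_mul_distrib, Finset.prod_mul_distrib,
    prod_one_sub_mul_of_geom_sum h, prod_one_sub_mul_of_geom_sum h, Finset.prod_const,
    Finset.card_range, mul_pow, mul_pow, h5, h5']
  have e : u ^ 5 * v ^ 5 = 1 := by rw [← mul_pow, huv, one_pow]
  linear_combination (-11 - u ^ 5) * e - 25 * u ^ 10 * v ^ 5 * hg

lemma ofReal_euler {x : ℝ} (hx : ‖x‖ < 1) : ((euler x : ℝ) : ℂ) = euler (x : ℂ) := by
  have hm := multipliable_one_sub_pow_linear hx one_pos 1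
  simp only [one_mul] at hm
  have h := hm.map_tprod Complex.ofRealHom Complex.continuous_ofReal
  simpa [euler] using h

/-- The norm of the Euler product over the fifth roots of unity. -/
lemma prod_euler_root_of_unity {ξ : ℂ} (hξ : ξ ^ 5 = 1) (h : 1 + ξ + ξ ^ 2 + ξ ^ 3 + ξ ^ 4 = 0)
    {r : ℂ} (hr : ‖r‖ < 1) :
    (∏ j ∈ Finset.range 5, euler (ξ ^ j * r)) * euler ((r ^ 5) ^ 5) = euler (r ^ 5) ^ 6 := by
  have hξn : ‖ξ‖ = 1 := Complex.norm_eq_one_of_pow_eq_one hξ (by norm_num)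
  have hr5 : ‖r ^ 5‖ < 1 := by
    rw [norm_pow]; exact pow_lt_one₀ (norm_nonneg _) hr (by norm_num)
  have hjr : ∀ j, ‖ξ ^ j * r‖ < 1 := fun j => by rwa [norm_mul, norm_pow, hξn, one_pow, one_mul]
  -- Exponents prime to 5 permute the fifth roots of unity, so the norm of each factor is `1 - y^5`;
  -- exponents divisible by 5 make all five factors equal (`hlast`).
  have hfac : ∀ i ξ', ξ' = ξ ^ (i + 1) → 1 + ξ' + ξ' ^ 2 + ξ' ^ 3 + ξ' ^ 4 = 0 →
      ∏ j ∈ Finset.range 5, ∏' n : ℕ, (1 - (ξ ^ j * r) ^ (5 * n + (i + 1))) =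
        ∏' n : ℕ, (1 - (r ^ 5) ^ (5 * n + (i + 1))) := by
    intro i ξ' hξ' h'
    rw [← Multipliable.tprod_finsetProd fun j _ =>
      multipliable_one_sub_pow_linear (hjr j) (by norm_num) _]
    refine tprod_congr fun n => ?_
    rw [← pow_right_comm, ← prod_one_sub_mul_of_geom_sum h']
    refine Finset.prod_congr rfl fun j _ => ?_
    rw [mul_pow, hξ', ← pow_mul, ← pow_mul, mul_add, pow_add, mul_left_comm, pow_mul ξ 5, hξ,
      one_pow, one_mul, mul_comm j]
  have hlast : ∏ j ∈ Finset.range 5, ∏' n : ℕ, (1 - (ξ ^ j * r) ^ (5 * n + (4 + 1))) =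
      euler (r ^ 5) ^ 5 := by
    have hj : ∀ j ∈ Finset.range 5, ∏' n : ℕ, (1 - (ξ ^ j * r) ^ (5 * n + (4 + 1))) =
        euler (r ^ 5) := fun j _ => tprod_congr fun n => by
      rw [show 5 * n + (4 + 1) = 5 * (n + 1) by ring, pow_mul, mul_pow, ← pow_mul, mul_comm j,
        pow_mul, hξ, one_pow, one_mul]
    rw [Finset.prod_congr rfl hj, Finset.prod_const, Finset.card_range]
  have h5 : ∏' n : ℕ, (1 - (r ^ 5) ^ (5 * n + (4 + 1))) = euler ((r ^ 5) ^ 5) :=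
    tprod_congr fun n => by rw [show 5 * n + (4 + 1) = 5 * (n + 1) by ring, pow_mul]
  have e := euler_eq_prod_residues hr5 (m := 5) (by norm_num)
  have hP : ∏ i ∈ Finset.range 4, ∏ j ∈ Finset.range 5,
      ∏' n : ℕ, (1 - (ξ ^ j * r) ^ (5 * n + (i + 1))) =
      ∏ i ∈ Finset.range 4, ∏' n : ℕ, (1 - (r ^ 5) ^ (5 * n + (i + 1))) := by
    refine Finset.prod_congr rfl fun i hi => ?_
    have hi4 := Finset.mem_range.1 hi
    refine hfac i _ rfl ?_
    interval_cases i
    · linear_combination h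
    · linear_combination h + (ξ + ξ ^ 3) * hξ
    · linear_combination h + (ξ + ξ ^ 4 + ξ ^ 2 * (ξ ^ 5 + 1)) * hξ
    · linear_combination h + (ξ ^ 3 + ξ ^ 2 * (ξ ^ 5 + 1) + ξ * (ξ ^ 10 + ξ ^ 5 + 1)) * hξ
  rw [Finset.prod_range_succ, h5] at e
  rw [Finset.prod_congr rfl fun j _ => euler_eq_prod_residues (hjr j) (m := 5) (by norm_num),
    Finset.prod_comm, Finset.prod_range_succ, hlast, hP, mul_right_comm, ← e, ← pow_succ']

/-- Ramanujan's relation between the continued fraction and the eta function. -/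
theorem R_relation {u : ℝ} (hu : 0 < u) :
    (R (Real.exp (-u))) ^ (-5 : ℤ) - 11 - R (Real.exp (-u)) ^ 5 =
      (etaExp u / etaExp (5 * u)) ^ 6 := by
  have hA := thetaA_pos hu
  have hB := thetaB_pos hu
  have hη := etaExp_pos (u := 5 * u) (by positivity)
  have e5 : etaExp (5 * u) = altTheta (15 * u / 2) (-1 / 6) := by
    rw [etaExp_eq_altTheta (by positivity)]; ring_nf
  have d0 := dissection_zero_mul hu
  have d2 := dissection_two_mul hu
  rw [← e5] at d0 d2
  set ρ := R (Real.exp (-u)) with hρ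
  have hρ' : ρ = thetaA u / thetaB u := R_exp hu
  have hρ0 : ρ ≠ 0 := by rw [hρ']; positivity
  -- Together with `c2`, this makes the dissection `η(q^5) (ρ⁻¹ - X - X² ρ)` up to an exponential
  -- factor, whose norm is known.
  have c0 : altTheta (15 * u / 2) (-1 / 30) + altTheta (15 * u / 2) (11 / 30) =
      etaExp (5 * u) * ρ⁻¹ := by
    rw [hρ', inv_div, ← mul_div_assoc, eq_div_iff hA.ne', d0]
  have c2 : altTheta (15 * u / 2) (17 / 30) - altTheta (15 * u / 2) (23 / 30) =
      etaExp (5 * u) * ρ := by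
    rw [hρ', ← mul_div_assoc, eq_div_iff hB.ne', d2]
  have hprim := Complex.isPrimitiveRoot_exp 5 (by norm_num)
  set ξ : ℂ := Complex.exp (2 * Real.pi * Complex.I / (5 : ℕ))
  have hξ : ξ ^ 5 = 1 := hprim.pow_eq_one
  have hg : 1 + ξ + ξ ^ 2 + ξ ^ 3 + ξ ^ 4 = 0 := by
    have := hprim.geom_sum_eq_zero (by norm_num)
    simpa [Finset.sum_range_succ] using this
  have hr : ‖((Real.exp (-(u / 5)) : ℝ) : ℂ)‖ < 1 := by
    rw [Complex.norm_real]; exact norm_exp_neg_lt_one (by positivity)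
  have key := prod_euler_root_of_unity hξ hg hr
  have hd : ∀ j ∈ Finset.range 5, euler (ξ ^ j * ((Real.exp (-(u / 5)) : ℝ) : ℂ)) =
      ((Real.exp (u / 120) * etaExp (5 * u) : ℝ) : ℂ) *
        (((ρ⁻¹ : ℝ) : ℂ) - ξ ^ j - (ξ ^ j) ^ 2 * (ρ : ℂ)) := by
    intro j _
    rw [euler_dissection (by rw [← pow_mul, mul_comm, pow_mul, hξ, one_pow]) hu, c0, c2, ← e5]
    push_cast
    ring
  have hinv : (ρ : ℂ) * ((ρ⁻¹ : ℝ) : ℂ) = 1 := by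
    rw [← Complex.ofReal_mul, mul_inv_cancel₀ hρ0, Complex.ofReal_one]
  rw [Finset.prod_congr rfl hd, Finset.prod_mul_distrib, prod_quadratic_of_geom_sum hg hinv,
    Finset.prod_const, Finset.card_range, ← Complex.ofReal_pow (Real.exp _),
    ← Complex.ofReal_pow (Real.exp _ ^ 5), exp_neg_pow, exp_neg_pow,
    ← ofReal_euler (norm_exp_neg_lt_one (by positivity)),
    ← ofReal_euler (norm_exp_neg_lt_one (by positivity))] at key
  have key' : (Real.exp (u / 120) * etaExp (5 * u)) ^ 5 * (ρ⁻¹ ^ 5 - 11 - ρ ^ 5) *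
      euler (Real.exp (-(5 * u))) = euler (Real.exp (-u)) ^ 6 := by
    have e1 : ((5 : ℕ) : ℝ) * (((5 : ℕ) : ℝ) * (u / 5)) = 5 * u := by push_cast; ring
    have e2 : ((5 : ℕ) : ℝ) * (u / 5) = u := by push_cast; ring
    rw [e1, e2] at key
    exact_mod_cast key
  have x1 : euler (Real.exp (-(5 * u))) = Real.exp (5 * u / 24) * etaExp (5 * u) := by
    rw [etaExp, ← mul_assoc, ← Real.exp_add]; ring_nf; simp
  have x2 : euler (Real.exp (-u)) = Real.exp (u / 24) * etaExp u := by
    rw [etaExp, ← mul_assoc, ← Real.exp_add]; ring_nf; simp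
  rw [x1, x2, mul_pow, mul_pow (Real.exp (u / 24)), ← Real.exp_nat_mul, ← Real.exp_nat_mul] at key'
  have x3 : Real.exp (((5 : ℕ) : ℝ) * (u / 120)) * Real.exp (5 * u / 24) =
      Real.exp (((6 : ℕ) : ℝ) * (u / 24)) := by
    rw [← Real.exp_add]; push_cast; ring_nf
  rw [← x3] at key'
  have hz : ρ ^ (-5 : ℤ) = ρ⁻¹ ^ 5 := by
    rw [zpow_neg, inv_pow]; norm_cast
  rw [hz, div_pow, eq_div_iff (by positivity)]
  have hne : Real.exp (((5 : ℕ) : ℝ) * (u / 120)) * Real.exp (5 * u / 24) ≠ 0 := by positivity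
  apply mul_left_cancel₀ hne
  linear_combination key'

end Dissection

/-! ### The substitution `v = R(e^{-πt})`. -/

section ChangeOfVariables

lemma eta_eq (t : ℝ) (ht : 0 < t) :
    ModularForm.eta (Complex.I * t / 2) = (etaExp (Real.pi * t) : ℝ) := by
  have e : 2 * Real.pi * Complex.I * (Complex.I * t / 2) = ((-(Real.pi * t) : ℝ) : ℂ) := by
    push_cast
    linear_combination (Real.pi * t : ℂ) * Complex.I_mul_I
  have hu : 0 < Real.pi * t := by positivity
  rw [ModularForm.eta, Function.Periodic.qParam, etaExp, Complex.ofReal_mul,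
    ofReal_euler (norm_exp_neg_lt_one hu), euler, e]
  simp only [ModularForm.eta_q_eq_pow, e]
  push_cast
  ring_nf

/-- The continued fraction as a function of `t`, where `q = e^{-πt}`. -/
noncomputable def rrFun (t : ℝ) : ℝ := R (Real.exp (-Real.pi * t))

lemma rrFun_eq (t : ℝ) : rrFun t = R (Real.exp (-(Real.pi * t))) := by
  rw [rrFun, neg_mul]

lemma rrFun_zero : rrFun 0 = rMax := by simp [rrFun, R_one]

lemma rrFun_pos {t : ℝ} (ht : 0 < t) : 0 < rrFun t := by
  have hu : 0 < Real.pi * t := by positivity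
  rw [rrFun_eq, R_exp hu]
  exact div_pos (thetaA_pos hu) (thetaB_pos hu)

/-- The derivative of `rrFun`. -/
noncomputable def rrDeriv (t : ℝ) : ℝ :=
  -(Real.pi / 5 * rrFun t * (etaExp (Real.pi * t) ^ 5 / etaExp (5 * (Real.pi * t))))

lemma hasDerivAt_rrFun {t : ℝ} (ht : 0 < t) : HasDerivAt rrFun (rrDeriv t) t := by
  have hu : 0 < Real.pi * t := by positivity
  have hd : HasDerivAt (fun t : ℝ => Real.pi * t) Real.pi t := by
    simpa using (hasDerivAt_id t).const_mul Real.pi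
  have h := HasDerivAt.comp (h₂ := fun u => R (Real.exp (-u))) t (hasDerivAt_R_exp hu) hd
  have e : rrFun = (fun u => R (Real.exp (-u))) ∘ fun t : ℝ => Real.pi * t := funext rrFun_eq
  rw [e]
  refine h.congr_deriv ?_
  rw [rrDeriv, rrFun_eq]
  ring

lemma rrDeriv_neg {t : ℝ} (ht : 0 < t) : rrDeriv t < 0 := by
  have h1 := etaExp_pos (u := Real.pi * t) (by positivity)
  have h2 := etaExp_pos (u := 5 * (Real.pi * t)) (by positivity)
  have := rrFun_pos ht
  have : 0 < Real.pi / 5 * rrFun t *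
    (etaExp (Real.pi * t) ^ 5 / etaExp (5 * (Real.pi * t))) := by positivity
  rw [rrDeriv]
  linarith

lemma continuousOn_rrFun : ContinuousOn rrFun (Set.Ici 0) := by
  intro t ht
  -- At `t = 0` the nome is `1`, and only the one-sided limit from `tendsto_R_one` is available.
  rcases eq_or_lt_of_le (Set.mem_Ici.1 ht) with rfl | ht
  · rw [← continuousWithinAt_Ioi_iff_Ici, ContinuousWithinAt, rrFun_zero]
    refine tendsto_R_one.comp (tendsto_nhdsWithin_iff.2 ⟨?_, ?_⟩)
    · have : Continuous fun t : ℝ => Real.exp (-Real.pi * t) := by fun_prop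
      simpa using this.continuousAt.tendsto.mono_left (nhdsWithin_le_nhds (a := (0 : ℝ)))
    · filter_upwards [self_mem_nhdsWithin] with t ht
      rw [neg_mul]
      exact exp_neg_lt_one (mul_pos Real.pi_pos ht)
  · exact (hasDerivAt_rrFun ht).continuousAt.continuousWithinAt

lemma strictAntiOn_rrFun : StrictAntiOn rrFun (Set.Ici 0) := by
  refine strictAntiOn_of_deriv_neg (convex_Ici 0) continuousOn_rrFun fun t ht => ?_
  rw [interior_Ici] at ht
  rw [(hasDerivAt_rrFun ht).deriv]
  exact rrDeriv_neg ht

lemma tendsto_rrFun_atTop : Tendsto rrFun atTop (𝓝 0) := by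
  have h : Tendsto (fun t : ℝ => Real.exp (-(Real.pi * t / 5))) atTop (𝓝 0) :=
    Real.tendsto_exp_neg_atTop_nhds_zero.comp
      ((tendsto_id.const_mul_atTop Real.pi_pos).atTop_div_const (by norm_num))
  refine squeeze_zero' ?_ ?_ h
  · filter_upwards [eventually_gt_atTop 0] with t ht using (rrFun_pos ht).le
  · filter_upwards [eventually_gt_atTop 0] with t ht
    rw [rrFun_eq]
    exact R_exp_le (by positivity)

lemma exists_rrFun_eq {s v : ℝ} (hs : 0 ≤ s) (hv0 : 0 < v) (hv : v ≤ rrFun s) :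
    ∃ t, s ≤ t ∧ rrFun t = v := by
  obtain ⟨T, hT, hsT⟩ := ((tendsto_rrFun_atTop.eventually (gt_mem_nhds hv0)).and
    (eventually_ge_atTop s)).exists
  obtain ⟨t, ht, e⟩ := intermediate_value_Icc' hsT
    (continuousOn_rrFun.mono fun x hx => hs.trans hx.1) ⟨le_of_lt hT, hv⟩
  exact ⟨t, ht.1, e⟩

lemma image_rrFun_Ioi {s : ℝ} (hs : 0 ≤ s) : rrFun '' Set.Ioi s = Set.Ioo 0 (rrFun s) := by
  ext v
  constructor
  · rintro ⟨t, ht, rfl⟩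
    have ht0 : 0 < t := hs.trans_lt ht
    exact ⟨rrFun_pos ht0, strictAntiOn_rrFun hs ht0.le ht⟩
  · rintro ⟨h0, h1⟩
    obtain ⟨t, ht, e⟩ := exists_rrFun_eq hs h0 h1.le
    refine ⟨t, lt_of_le_of_ne ht fun h => ?_, e⟩
    rw [h, e] at h1
    exact lt_irrefl _ h1

/-- By `R_relation` the sixth root is `η(q)/η(q^5)`; dividing the Jacobian `(π/5) R η(q)^5/η(q^5)`
by `R` times this root leaves `(π/5) η(q)^4`. -/
lemma abs_rrDeriv_mul_integrand (G : ℝ → ℝ) {t : ℝ} (ht : 0 < t) :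
    etaIntegrand G t = ((5 / Real.pi * (|rrDeriv t| • integrand G (rrFun t)) : ℝ) : ℂ) := by
  have hu : 0 < Real.pi * t := by positivity
  have h1 := etaExp_pos hu
  have h2 := etaExp_pos (u := 5 * (Real.pi * t)) (by positivity)
  have h3 := rrFun_pos ht
  have hroot : (rrFun t ^ (-5 : ℤ) - 11 - rrFun t ^ 5) ^ (1 / 6 : ℝ) =
      etaExp (Real.pi * t) / etaExp (5 * (Real.pi * t)) := by
    rw [rrFun_eq, R_relation hu, ← Real.rpow_natCast, ← Real.rpow_mul (by positivity)]
    norm_num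
  rw [etaIntegrand, eta_eq t ht, ← rrFun, ← Complex.ofReal_pow, ← Complex.ofReal_mul,
    abs_of_neg (rrDeriv_neg ht), integrand, hroot, rrDeriv, smul_eq_mul]
  congr 1
  have := Real.pi_pos
  generalize etaExp (5 * (Real.pi * t)) = e at *
  field_simp

/-- The substitution maps `(s, ∞)` bijectively onto `(0, rrFun s)`, transferring integrability and
value alike. Derivatives are needed only on the open half-line, so `s = 0` is covered. -/
lemma isValue_of_intervalIntegrable {G : ℝ → ℝ} {s : ℝ} (hs : 0 ≤ s) (hpos : 0 < rrFun s)
    (hint : IntervalIntegrable (integrand G) MeasureTheory.volume 0 (rrFun s)) :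
    IsValue G (5 * ∫ t in (0 : ℝ)..rrFun s, integrand G t) (s ^ 2) := by
  have hd : ∀ t ∈ Set.Ioi s, HasDerivWithinAt rrFun (rrDeriv t) (Set.Ioi s) t := fun t ht =>
    (hasDerivAt_rrFun (hs.trans_lt ht)).hasDerivWithinAt
  have hinj : Set.InjOn rrFun (Set.Ioi s) :=
    strictAntiOn_rrFun.injOn.mono fun t ht => hs.trans (le_of_lt ht)
  have hcongr : Set.EqOn (etaIntegrand G)
      (fun t => ((5 / Real.pi * (|rrDeriv t| • integrand G (rrFun t)) : ℝ) : ℂ)) (Set.Ioi s) :=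
    fun t ht => abs_rrDeriv_mul_integrand G (hs.trans_lt ht)
  rw [intervalIntegrable_iff_integrableOn_Ioo_of_le hpos.le, ← image_rrFun_Ioi hs,
    MeasureTheory.integrableOn_image_iff_integrableOn_abs_deriv_smul measurableSet_Ioi hd hinj]
    at hint
  refine ⟨sq_nonneg s, ?_, ?_⟩
  · rw [Real.sqrt_sq hs, MeasureTheory.integrableOn_congr_fun hcongr measurableSet_Ioi]
    exact (hint.const_mul (5 / Real.pi)).ofReal
  · rw [Real.sqrt_sq hs, MeasureTheory.setIntegral_congr_fun measurableSet_Ioi hcongr,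
      integral_complex_ofReal, MeasureTheory.integral_const_mul,
      intervalIntegral.integral_of_le hpos.le, MeasureTheory.integral_Ioc_eq_integral_Ioo,
      ← image_rrFun_Ioi hs,
      MeasureTheory.integral_image_eq_integral_abs_deriv_smul measurableSet_Ioi hd hinj]
    have := Real.pi_ne_zero
    push_cast
    field_simp

end ChangeOfVariables

end RogersRamanujan

theorem theorem1 (G : ℝ → ℝ)
    (hG : ContDiffOn ℝ ∞ G (Set.Ioo 0 RogersRamanujan.rMax))
    (A y : ℝ) (hy0 : 0 < y) (hy1 : y ≤ RogersRamanujan.rMax)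
    (hint : IntervalIntegrable (RogersRamanujan.integrand G) MeasureTheory.volume 0 y)
    (hA : 5 * (∫ t in (0 : ℝ)..y, RogersRamanujan.integrand G t) = A) :
    (∃ m : ℝ, RogersRamanujan.IsValue G A m ∧
      y = RogersRamanujan.R (Real.exp (-Real.pi * √m))) ∧
    ((∀ m m' : ℝ, RogersRamanujan.IsValue G A m → RogersRamanujan.IsValue G A m' → m = m') →
      RogersRamanujan.IsValue G A (RogersRamanujan.mG G A) ∧
        y = RogersRamanujan.R (Real.exp (-Real.pi * √(RogersRamanujan.mG G A)))) := by
  obtain ⟨s, hs, rfl⟩ := RogersRamanujan.exists_rrFun_eq le_rfl hy0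
    (hy1.trans_eq RogersRamanujan.rrFun_zero.symm)
  have hv := RogersRamanujan.isValue_of_intervalIntegrable hs hy0 hint
  rw [hA] at hv
  have he : RogersRamanujan.rrFun s = RogersRamanujan.R (Real.exp (-Real.pi * √(s ^ 2))) := by
    rw [Real.sqrt_sq hs, RogersRamanujan.rrFun]
  refine ⟨⟨s ^ 2, hv, he⟩, fun huniq => ?_⟩
  have hex : ∃ m, RogersRamanujan.IsValue G A m := ⟨_, hv⟩
  have hm : RogersRamanujan.IsValue G A (RogersRamanujan.mG G A) := by
    rw [RogersRamanujan.mG, dif_pos hex]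
    exact hex.choose_spec
  -- `mG` chooses an arbitrary solution; uniqueness identifies it with `s ^ 2`.
  exact ⟨hm, by rw [huniq _ _ hm hv]; exact he⟩
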